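/- A C*-algebra (not necessarily unital) is approximately finite (AF) if it is the norm closure of the union of an increasing sequence of finite-dimensional C*-subalgebras. It is simple if it is nonzero and has no closed two-sided ideals other than $0$ and itself. Let $\mathcal{K}$ be the algebra of compact operators on $\ell^2(\mathbb{N})$, and let $F=\varinjlim M_{2^k}(\mathbb{C})$ be the Fermion (CAR) algebra, the C*-algebra inductive limit under the unital embeddings $a\mapsto \operatorname{diag}(a,a)$. For Banach spaces $X,Y$ write $X\approx Y$ if there is a linear homeomorphism of $X$ onto $Y$. Corollary 1.4. Let $A$ be a simple infinite-dimensional AF C*-algebra. Then $A\approx\mathcal{K}$ or $A\approx F$. -/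

import Mathlib

open scoped ENNReal lp

noncomputable section

/-! ### Simple approximately finite C*-algebras -/

/-- A (not necessarily unital) C*-algebra is approximately finite if it is the closed union of an
increasing sequence of finite-dimensional C*-subalgebras (finite-dimensional `*`-subalgebras are
automatically closed). -/
def IsAFAlgebra (A : Type*) [NonUnitalCStarAlgebra A] : Prop :=
  ∃ B : ℕ → NonUnitalStarSubalgebra ℂ A,
    Monotone B ∧ (∀ n, FiniteDimensional ℂ (B n)) ∧ Dense (⋃ n, (B n : Set A))

/-- A C*-algebra is simple if it is nonzero and its only closed two-sided ideals are `0` and the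
whole algebra. -/
def IsSimpleCStarAlgebra (A : Type*) [NonUnitalCStarAlgebra A] : Prop :=
  Nontrivial A ∧ ∀ I : Submodule ℂ A, IsClosed (I : Set A) →
    (∀ a : A, ∀ x ∈ I, a * x ∈ I ∧ x * a ∈ I) → I = ⊥ ∨ I = ⊤

/-! ### The compact operators -/

/-- The separable infinite-dimensional Hilbert space `ℓ²(ℕ)`. -/
abbrev HilbertEllTwo : Type := ℓ²(ℕ, ℂ)

/-- The Banach space of compact operators on `ℓ²(ℕ)`, with the operator norm. -/
abbrev CompactOperatorAlgebra : Submodule ℂ (HilbertEllTwo →L[ℂ] HilbertEllTwo) :=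
  compactOperator (RingHom.id ℂ) HilbertEllTwo HilbertEllTwo

/-! ### The Fermion algebra

The inductive limit of the matrix algebras `M_{2^k}` under the unital embeddings
`a ↦ diag(a, a)` is realised on `ℓ²(ℕ)`: the matrix `a ∈ M_{2^k}` acts as the block diagonal
operator `diag(a, a, a, …)`, and the Fermion algebra is the norm closure of the union of these
matrix algebras. -/

/-- The standard basis vectors of `ℓ²(ℕ)`. -/
def basisVec (n : ℕ) : HilbertEllTwo := lp.single 2 n (1 : ℂ)

theorem inner_basisVec_left (m : ℕ) (f : HilbertEllTwo) : inner ℂ (basisVec m) f = f m := by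
  simp [basisVec, lp.inner_single_left]

theorem inner_basisVec (m n : ℕ) :
    inner ℂ (basisVec m) (basisVec n) = if m = n then (1 : ℂ) else 0 := by
  rw [inner_basisVec_left]
  simp [basisVec, Pi.single_apply]

theorem orthonormal_basisVec_comp {g : ℕ → ℕ} (hg : Function.Injective g) :
    Orthonormal ℂ (fun m => basisVec (g m)) := by
  rw [orthonormal_iff_ite]
  intro m n
  simp [inner_basisVec, hg.eq_iff]

/-- Bounded operators on `ℓ²(ℕ)` are determined by their values on basis vectors. -/
theorem clm_ext_basisVec {T S : HilbertEllTwo →L[ℂ] HilbertEllTwo}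
    (h : ∀ n, T (basisVec n) = S (basisVec n)) : T = S := by
  refine lp.ext_continuousLinearMap (by norm_num) fun n => ?_
  ext1
  simpa [basisVec] using h n

theorem injective_block {N : ℕ} (i : Fin N) :
    Function.Injective (fun m : ℕ => N * m + (i : ℕ)) := by
  intro m n h
  have hN : 0 < N := i.pos
  simpa [hN.ne'] using h

/-- The isometry of `ℓ²(ℕ)` with `e_m ↦ e_{N m + i}`, which sends `e_m` to the `i`-th vector of
the `m`-th block of length `N`. -/
def blockIsometry (N : ℕ) (i : Fin N) : HilbertEllTwo →L[ℂ] HilbertEllTwo :=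
  ((orthonormal_basisVec_comp (injective_block i)).orthogonalFamily).linearIsometry
    |>.toContinuousLinearMap

theorem blockIsometry_basisVec (N : ℕ) (i : Fin N) (m : ℕ) :
    blockIsometry N i (basisVec m) = basisVec (N * m + i) := by
  simp [blockIsometry, basisVec]

theorem star_blockIsometry_basisVec (N : ℕ) (i : Fin N) (n : ℕ) :
    star (blockIsometry N i) (basisVec n) = if n % N = i then basisVec (n / N) else 0 := by
  have hN : 0 < N := i.pos
  ext m
  rw [← inner_basisVec_left, ContinuousLinearMap.star_eq_adjoint,
    ContinuousLinearMap.adjoint_inner_right, blockIsometry_basisVec, inner_basisVec]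
  have key : N * m + i = n ↔ (n % N = i ∧ m = n / N) := by
    constructor
    · rintro rfl
      refine ⟨by simp [Nat.mod_eq_of_lt i.isLt], ?_⟩
      rw [Nat.mul_add_div hN, Nat.div_eq_of_lt i.isLt, add_zero]
    · rintro ⟨h1, h2⟩
      rw [h2, ← h1]
      exact Nat.div_add_mod n N
  by_cases h : n % N = i
  · rw [if_pos h, ← inner_basisVec_left, inner_basisVec]
    simp [key, h]
  · simp [key, h]

theorem star_blockIsometry_mul (N : ℕ) (i j : Fin N) :
    star (blockIsometry N i) * blockIsometry N j = if i = j then 1 else 0 := by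
  have hN : 0 < N := i.pos
  refine clm_ext_basisVec fun n => ?_
  rw [mul_apply_eq_comp, blockIsometry_basisVec, star_blockIsometry_basisVec,
    Nat.mul_add_mod, Nat.mod_eq_of_lt j.isLt, Nat.mul_add_div hN, Nat.div_eq_of_lt j.isLt,
    add_zero]
  by_cases h : i = j
  · simp [h]
  · have h' : ¬ ((j : ℕ) = i) := fun e => h (Fin.ext e.symm)
    simp [h, h']

theorem sum_blockIsometry_mul_star (N : ℕ) (hN : 0 < N) :
    ∑ i, blockIsometry N i * star (blockIsometry N i) = 1 := by
  refine clm_ext_basisVec fun n => ?_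
  rw [sum_apply,
    Finset.sum_eq_single (⟨n % N, Nat.mod_lt n hN⟩ : Fin N)]
  · simp [star_blockIsometry_basisVec, blockIsometry_basisVec, Nat.div_add_mod]
  · intro i _ hi
    have : ¬ (n % N = i) := fun e => hi (Fin.ext e.symm)
    simp [star_blockIsometry_basisVec, this]
  · simp

/-- The operator on `ℓ²(ℕ)` with block diagonal matrix `diag(a, a, a, …)`. -/
def blockDiagOperator (N : ℕ) (a : Matrix (Fin N) (Fin N) ℂ) :
    HilbertEllTwo →L[ℂ] HilbertEllTwo :=
  ∑ i, ∑ j, a i j • (blockIsometry N i * star (blockIsometry N j))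

/-- The matrix of `blockDiagOperator N a` is the block diagonal matrix `diag(a, a, a, …)`. -/
theorem inner_blockDiagOperator (N : ℕ) (hN : 0 < N) (a : Matrix (Fin N) (Fin N) ℂ) (p q : ℕ) :
    inner ℂ (basisVec p) (blockDiagOperator N a (basisVec q)) =
      if p / N = q / N then a ⟨p % N, Nat.mod_lt p hN⟩ ⟨q % N, Nat.mod_lt q hN⟩ else 0 := by
  have hstep : ∀ i j : Fin N, inner ℂ (basisVec p)
      ((blockIsometry N i * star (blockIsometry N j)) (basisVec q)) =
      if i = ⟨p % N, Nat.mod_lt p hN⟩ then (if j = ⟨q % N, Nat.mod_lt q hN⟩ then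
        (if p / N = q / N then (1 : ℂ) else 0) else 0) else 0 := by
    intro i j
    rw [mul_apply_eq_comp, ← ContinuousLinearMap.adjoint_inner_left,
      ← ContinuousLinearMap.star_eq_adjoint, star_blockIsometry_basisVec,
      star_blockIsometry_basisVec]
    simp only [Fin.ext_iff, eq_comm (a := (i : ℕ)), eq_comm (a := (j : ℕ))]
    split_ifs <;> simp only [inner_basisVec, inner_zero_left, inner_zero_right] <;> simp_all
  simp only [blockDiagOperator, sum_apply, smul_apply,
    inner_sum, inner_smul_right, hstep]
  rw [Finset.sum_eq_single (⟨p % N, Nat.mod_lt p hN⟩ : Fin N),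
    Finset.sum_eq_single (⟨q % N, Nat.mod_lt q hN⟩ : Fin N)]
  · simp
  · intro j _ hj
    simp [hj]
  · simp
  · intro i _ hi
    simp [hi]
  · simp

/-- The unital `*`-homomorphism `M_{2^k} → B(ℓ²(ℕ))`, `a ↦ diag(a, a, a, …)`. -/
def fermionRep (k : ℕ) :
    Matrix (Fin (2 ^ k)) (Fin (2 ^ k)) ℂ →⋆ₐ[ℂ] (HilbertEllTwo →L[ℂ] HilbertEllTwo) where
  toFun a := blockDiagOperator (2 ^ k) a
  map_one' := by
    simp only [blockDiagOperator, Matrix.one_apply, ite_smul, one_smul, zero_smul,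
      Finset.sum_ite_eq, Finset.mem_univ, if_true]
    exact sum_blockIsometry_mul_star _ (by positivity)
  map_mul' a b := by
    have hmul : ∀ i j l m : Fin (2 ^ k),
        (blockIsometry (2 ^ k) i * star (blockIsometry (2 ^ k) j)) *
          (blockIsometry (2 ^ k) l * star (blockIsometry (2 ^ k) m)) =
        if j = l then blockIsometry (2 ^ k) i * star (blockIsometry (2 ^ k) m) else 0 := by
      intro i j l m
      rw [mul_assoc, ← mul_assoc (star _), star_blockIsometry_mul]
      split_ifs <;> simp
    simp only [blockDiagOperator, Matrix.mul_apply, Finset.sum_mul, Finset.mul_sum,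
      smul_mul_smul_comm, hmul, smul_ite, smul_zero, Finset.sum_smul]
    simp only [Finset.sum_ite_eq', Finset.mem_univ, if_true]
    refine (Finset.sum_congr rfl fun i _ => Finset.sum_comm).trans (Finset.sum_comm.trans ?_)
    exact Finset.sum_congr rfl fun l _ => Finset.sum_comm
  map_zero' := by simp [blockDiagOperator]
  map_add' a b := by simp [blockDiagOperator, add_smul, Finset.sum_add_distrib]
  commutes' r := by
    simp only [blockDiagOperator, Algebra.algebraMap_eq_smul_one, Matrix.smul_apply,
      Matrix.one_apply, smul_ite, smul_zero, ite_smul, zero_smul, Finset.sum_ite_eq,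
      Finset.mem_univ, if_true, ← sum_blockIsometry_mul_star (2 ^ k) (by positivity),
      Finset.smul_sum]
    simp
  map_star' a := by
    simp only [blockDiagOperator, star_sum, star_smul, star_mul, star_star,
      Matrix.star_apply]
    rw [Finset.sum_comm]

/-- The embedding `a ↦ diag(a, a)` of `M_{2^k}` into `M_{2^(k+1)}`. -/
def doubleMatrix (k : ℕ) (a : Matrix (Fin (2 ^ k)) (Fin (2 ^ k)) ℂ) :
    Matrix (Fin (2 ^ (k + 1))) (Fin (2 ^ (k + 1))) ℂ := fun p q =>
  if (p : ℕ) / 2 ^ k = (q : ℕ) / 2 ^ k then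
    a ⟨(p : ℕ) % 2 ^ k, Nat.mod_lt _ (by positivity)⟩ ⟨(q : ℕ) % 2 ^ k, Nat.mod_lt _ (by positivity)⟩
  else 0

/-- The representations are compatible with the connecting maps of the inductive system. -/
theorem fermionRep_doubleMatrix (k : ℕ) (a : Matrix (Fin (2 ^ k)) (Fin (2 ^ k)) ℂ) :
    fermionRep (k + 1) (doubleMatrix k a) = fermionRep k a := by
  refine clm_ext_basisVec fun q => ?_
  ext p
  rw [← inner_basisVec_left, ← inner_basisVec_left]
  change inner ℂ _ (blockDiagOperator _ _ _) = inner ℂ _ (blockDiagOperator _ _ _)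
  rw [inner_blockDiagOperator _ (by positivity), inner_blockDiagOperator _ (by positivity)]
  have hdvd : 2 ^ k ∣ 2 ^ (k + 1) := pow_dvd_pow 2 (Nat.le_succ k)
  have hq : ∀ n : ℕ, n % 2 ^ (k + 1) / 2 ^ k = n / 2 ^ k % 2 := by
    intro n
    rw [pow_succ, Nat.mod_mul_right_div_self]
  have hd : ∀ n : ℕ, n / 2 ^ (k + 1) = n / 2 ^ k / 2 := by
    intro n
    rw [pow_succ, Nat.div_div_eq_div_mul]
  simp only [doubleMatrix, hq, hd, Nat.mod_mod_of_dvd _ hdvd]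
  by_cases h : p / 2 ^ k = q / 2 ^ k
  · simp [h]
  · rw [if_neg h]
    split_ifs with h1 h2
    · omega
    · rfl
    · rfl

/-- The Fermion (CAR) algebra: the norm closure of the union of the increasing sequence of matrix
algebras `M_{2^k}` acting on `ℓ²(ℕ)`. -/
def FermionAlgebra : StarSubalgebra ℂ (HilbertEllTwo →L[ℂ] HilbertEllTwo) :=
  (⨆ k, (fermionRep k).range).topologicalClosure

/-- The underlying set is the closed union of the matrix algebras. -/
theorem coe_fermionAlgebra :
    (FermionAlgebra : Set (HilbertEllTwo →L[ℂ] HilbertEllTwo)) =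
      closure (⋃ k, Set.range (fermionRep k)) := by
  have hmono : Monotone fun k => (fermionRep k).range := by
    refine monotone_nat_of_le_succ fun k => ?_
    rintro _ ⟨a, rfl⟩
    exact ⟨doubleMatrix k a, fermionRep_doubleMatrix k a⟩
  rw [FermionAlgebra, StarSubalgebra.topologicalClosure_coe,
    StarSubalgebra.coe_iSup_of_directed hmono.directed_le]
  rfl

end

/-!
A simple infinite-dimensional AF-algebra `A` is either elementary or "doubling".

Write `A` as the closed union of finite-dimensional subalgebras `S n`. If some nonzero projection
`p` satisfies `p A p = ℂ p`, then `A p` is a Hilbert space under `⟪x, y⟫ p = star x * y`, simplicity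
makes left multiplication on `A p` isometric and its image the compact operators, and `A` is
isomorphic to `𝒦`. Otherwise every minimal projection `e` of every `S n` dominates, at a later level,
two orthogonal equivalent minimal projections; this is `HasDoubling S`, and the alternative is
`IsSimpleCStarAlgebra.hasDoubling_or`. The Fermion algebra `F` also has doubling, because
`diag(a, a)` fixes two orthogonal copies of each vector fixed by `a`.

The core is `IsAFAlgebra.isComplementedIn`: *every* AF-algebra embeds as a complemented subspace in
any nonzero AF-algebra with doubling. Along the sequence of finite-dimensional subalgebras `R n` of the
first algebra, matrix units of `R n` are expressed through matrix units of `R (n + 1)`. Doubling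
leaves enough room in the second algebra to realise the matrix units of `R (n + 1)` below a
projection `q (n + 1)`, inside those already chosen for `R n`, in such a way that compression to
`q (n + 1)` maps the realisation of `R n` homomorphically onto its new realisation, and maps the
`n`-th algebra of the target into it (`Stage.exists_link`). The compressions therefore define a
contraction from the target onto the first algebra, and contractive projections `R (n + 1) → R n`
allow a contractive right inverse to be built step by step (`Stage.isComplementedIn`).

Hence, when `A` has doubling, `A` is complemented in `F` and `F` in `A`. The null sequences `C₀(ℕ, F)`
form an AF-algebra, so they are complemented in `F` too, and Pełczyński's decomposition method
(`nonempty_equiv_nullSequences`) gives `A ≃ C₀(ℕ, F) ≃ F`.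
-/

/-! ### Minimal projections in finite-dimensional C*-algebras -/

section MinimalProjections

variable {A : Type*} [NonUnitalCStarAlgebra A]

theorem star_mul_self_eq_zero' {x : A} (h : star x * x = 0) : x = 0 :=
  CStarRing.star_mul_self_eq_zero_iff x |>.1 h

/-- If `h` is a selfadjoint element of a finite-dimensional `*`-algebra `M`, then left
multiplication by `h` is injective, hence bijective, on `h M`; the element of `h M` which is mapped
to `h` is the support projection of `h`. -/
theorem exists_support_projection (M : NonUnitalStarSubalgebra ℂ A) [FiniteDimensional ℂ M]
    {h : A} (hM : h ∈ M) (hsa : star h = h) :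
    ∃ x ∈ M, IsStarProjection (h * x) ∧ h * x * h = h := by
  let L : A →ₗ[ℂ] A := LinearMap.mulLeft ℂ h
  let R : Submodule ℂ A := (M.toNonUnitalSubalgebra.toSubmodule).map L
  have : FiniteDimensional ℂ M.toNonUnitalSubalgebra.toSubmodule := ‹FiniteDimensional ℂ M›
  have : FiniteDimensional ℂ R := inferInstance
  have hL : ∀ x ∈ R, L x ∈ R := by
    rintro _ ⟨x, hx, rfl⟩
    have hx' : x ∈ M := hx
    exact ⟨h * x, (mul_mem hM hx' : h * x ∈ M), rfl⟩
  have key : ∀ y : A, h * (h * y) = 0 → h * y = 0 := fun y hy => by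
    apply star_mul_self_eq_zero'
    rw [star_mul, hsa, mul_assoc, hy, mul_zero]
  have hinj : Function.Injective (L.restrict hL) := by
    rw [← LinearMap.ker_eq_bot, LinearMap.ker_eq_bot']
    rintro ⟨_, ⟨y, hy, rfl⟩⟩ h0
    have : h * (h * y) = 0 := congrArg Subtype.val h0
    exact Subtype.ext (key y this)
  have hsurj := LinearMap.injective_iff_surjective.1 hinj
  have solve : ∀ y ∈ M, ∃ x ∈ M, h * (h * x) = h * y := fun y hy => by
    obtain ⟨⟨_, ⟨x, hx, rfl⟩⟩, hx'⟩ := hsurj ⟨h * y, ⟨y, hy, rfl⟩⟩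
    exact ⟨x, hx, congrArg Subtype.val hx'⟩
  obtain ⟨y, hy, hy'⟩ := solve h hM
  have hyh : h * y = h := by
    refine sub_eq_zero.1 (star_mul_self_eq_zero' ?_)
    have : h * (h * y - h) = 0 := by rw [mul_sub, hy', sub_self]
    rw [star_sub, star_mul, hsa, sub_mul, mul_assoc, this, mul_zero, sub_zero]
  obtain ⟨x, hx, hx'⟩ := solve y hy
  rw [hyh] at hx'
  have hxh : star x * h * h = h := by
    have := congrArg star hx'
    simpa only [star_mul, hsa] using this
  have hq : star x * h * (h * x) = h * x := by rw [← mul_assoc, hxh]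
  have hsq : star (h * x) = h * x := by
    rw [← hq]; simp only [star_mul, hsa, star_star, mul_assoc]
  have hsq' : star x * h = h * x := by rw [← hsq, star_mul, hsa]
  refine ⟨x, hx, ⟨?_, hsq⟩, ?_⟩
  · change h * x * (h * x) = h * x
    nth_rw 1 [← hsq']
    exact hq
  · rw [← hsq']
    exact hxh

/-- The corner `e M e` of a `*`-subalgebra `M` cut out by a projection `e`. -/
def corner (M : NonUnitalStarSubalgebra ℂ A) (e : A) : Submodule ℂ A where
  carrier := {y | y ∈ M ∧ e * y = y ∧ y * e = y}
  add_mem' := fun ⟨h1, h2, h3⟩ ⟨k1, k2, k3⟩ =>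
    ⟨add_mem h1 k1, by rw [mul_add, h2, k2], by rw [add_mul, h3, k3]⟩
  zero_mem' := ⟨zero_mem M, by simp, by simp⟩
  smul_mem' := fun c _ ⟨h1, h2, h3⟩ =>
    ⟨SMulMemClass.smul_mem c h1, by rw [mul_smul_comm, h2], by rw [smul_mul_assoc, h3]⟩

instance (M : NonUnitalStarSubalgebra ℂ A) [FiniteDimensional ℂ M] (e : A) :
    FiniteDimensional ℂ (corner M e) := by
  have : FiniteDimensional ℂ M.toNonUnitalSubalgebra.toSubmodule := ‹FiniteDimensional ℂ M›
  exact Submodule.finiteDimensional_of_le (S₂ := M.toNonUnitalSubalgebra.toSubmodule)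
    fun y hy => hy.1

theorem compress_mem_corner {M : NonUnitalStarSubalgebra ℂ A} {e x : A}
    (he : IsStarProjection e) (heM : e ∈ M) (hx : x ∈ M) : e * x * e ∈ corner M e :=
  ⟨mul_mem (mul_mem heM hx) heM,
    by rw [← mul_assoc, ← mul_assoc, he.isIdempotentElem.eq],
    by rw [mul_assoc, he.isIdempotentElem.eq]⟩

/-- If the corner `e M e` is not reduced to the scalars, then it has zero divisors: subtract an
eigenvalue from a non-scalar element. -/
theorem exists_zero_divisors_corner (M : NonUnitalStarSubalgebra ℂ A) [FiniteDimensional ℂ M]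
    {e : A} (he : IsStarProjection e) (heM : e ∈ M) {x : A} (hx : x ∈ M)
    (hns : ¬ ∃ c : ℂ, e * x * e = c • e) :
    ∃ h ∈ corner M e, ∃ z ∈ corner M e, star h = h ∧ h ≠ 0 ∧ z ≠ 0 ∧ h * z = 0 := by
  have hee : e * e = e := he.isIdempotentElem.eq
  have hse : star e = e := he.isSelfAdjoint.star_eq
  have hemem : e ∈ corner M e := ⟨heM, hee, hee⟩
  have he0 : e ≠ 0 := fun h => hns ⟨0, by simp [h]⟩
  obtain ⟨hy1, hy2, hy3⟩ := compress_mem_corner he heM hx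
  set y := e * x * e with hy
  have hL : ∀ z ∈ corner M e, LinearMap.mulLeft ℂ y z ∈ corner M e := fun z hz =>
    ⟨mul_mem hy1 hz.1, by simp [← mul_assoc, hy2], by simp [mul_assoc, hz.2.2]⟩
  have : Nontrivial (corner M e) := ⟨⟨e, hemem⟩, 0, fun h => he0 (congrArg Subtype.val h)⟩
  obtain ⟨c, hc⟩ := Module.End.exists_eigenvalue ((LinearMap.mulLeft ℂ y).restrict hL)
  obtain ⟨⟨z, hz⟩, hz1, hz2⟩ := hc.exists_hasEigenvector
  have hz0 : z ≠ 0 := fun h => hz2 (Subtype.ext h)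
  have hyz : y * z = c • z := congrArg Subtype.val (Module.End.mem_eigenspace_iff.1 hz1)
  let d := y - c • e
  have hd0 : d ≠ 0 := fun h => hns ⟨c, sub_eq_zero.1 h⟩
  have hdz : d * z = 0 := by
    simp only [d, sub_mul, smul_mul_assoc, hz.2.1, hyz, sub_self]
  have hd : d ∈ corner M e := (corner M e).sub_mem ⟨hy1, hy2, hy3⟩ ((corner M e).smul_mem c hemem)
  refine ⟨star d * d, ⟨mul_mem (star_mem hd.1) hd.1, ?_, by rw [mul_assoc, hd.2.2]⟩, z, hz,
    by simp, fun h => hd0 (star_mul_self_eq_zero' h), hz0, by rw [mul_assoc, hdz, mul_zero]⟩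
  have : e * star d = star d := by
    nth_rw 1 [← hse]
    rw [← star_mul, hd.2.2]
  rw [← mul_assoc, this]

/-- A minimal projection of a `*`-subalgebra: a nonzero projection whose corner consists of
scalars. -/
structure IsMinimalProjection (M : NonUnitalStarSubalgebra ℂ A) (p : A) : Prop where
  mem : p ∈ M
  isStarProjection : IsStarProjection p
  ne_zero : p ≠ 0
  compress : ∀ x ∈ M, ∃ c : ℂ, p * x * p = c • p

theorem IsMinimalProjection.mul_self {M : NonUnitalStarSubalgebra ℂ A} {p : A}
    (h : IsMinimalProjection M p) : p * p = p := h.isStarProjection.isIdempotentElem.eq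

theorem IsMinimalProjection.star_eq {M : NonUnitalStarSubalgebra ℂ A} {p : A}
    (h : IsMinimalProjection M p) : star p = p := h.isStarProjection.isSelfAdjoint.star_eq

theorem finrank_corner_lt {M : NonUnitalStarSubalgebra ℂ A} [FiniteDimensional ℂ M] {e q : A}
    (he : IsStarProjection e) (heM : e ∈ M) (hq : IsStarProjection q)
    (heq : e * q = q) (hne : q ≠ e) :
    Module.finrank ℂ (corner M q) < Module.finrank ℂ (corner M e) := by
  have hqe : q * e = q := by
    have := congrArg star heq
    rwa [star_mul, he.isSelfAdjoint.star_eq, hq.isSelfAdjoint.star_eq] at this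
  apply Submodule.finrank_lt_finrank_of_lt
  refine lt_of_le_of_ne ?_ ?_
  · rintro y ⟨h1, h2, h3⟩
    exact ⟨h1, by rw [← h2, ← mul_assoc, heq], by rw [← h3, mul_assoc, hqe]⟩
  · intro h
    have h1 : e ∈ corner M e :=
      ⟨heM, he.isIdempotentElem.eq, he.isIdempotentElem.eq⟩
    rw [← h] at h1
    exact hne (hqe.symm.trans h1.2.1)

theorem exists_isMinimalProjection_le (M : NonUnitalStarSubalgebra ℂ A) [FiniteDimensional ℂ M]
    {e : A} (he : IsStarProjection e) (heM : e ∈ M) (he0 : e ≠ 0) :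
    ∃ p, IsMinimalProjection M p ∧ e * p = p := by
  induction hk : Module.finrank ℂ (corner M e) using Nat.strong_induction_on generalizing e with
  | _ k ih =>
    by_cases hmin : ∀ x ∈ M, ∃ c : ℂ, e * x * e = c • e
    · exact ⟨e, ⟨heM, he, he0, hmin⟩, he.isIdempotentElem.eq⟩
    · push Not at hmin
      obtain ⟨x, hx, hx'⟩ := hmin
      obtain ⟨h, hh, z, hz, hsa, hh0, hz0, hhz⟩ :=
        exists_zero_divisors_corner M he heM hx (by simpa using hx')
      obtain ⟨y, hy, hq, hqh⟩ := exists_support_projection M hh.1 hsa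
      have hqM : h * y ∈ M := mul_mem hh.1 hy
      have heq : e * (h * y) = h * y := by rw [← mul_assoc, hh.2.1]
      have hne : h * y ≠ e := by
        intro hc
        apply hz0
        rw [← hz.2.1, ← hc, ← hq.isSelfAdjoint.star_eq, star_mul, hsa, mul_assoc, hhz, mul_zero]
      have hq0 : h * y ≠ 0 := fun hc => hh0 (by rw [← hqh, hc, zero_mul])
      obtain ⟨p, hp, hp'⟩ := ih _ (hk ▸ finrank_corner_lt he heM hq heq hne) hq hqM hq0 rfl
      exact ⟨p, hp, by rw [← hp', ← mul_assoc, heq]⟩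

theorem exists_isMinimalProjection {M : NonUnitalStarSubalgebra ℂ A} [FiniteDimensional ℂ M]
    {x : A} (hx : x ∈ M) (hx0 : x ≠ 0) : ∃ p, IsMinimalProjection M p := by
  obtain ⟨y, hy, hq, hqh⟩ := exists_support_projection M (mul_mem (star_mem hx) hx) (by simp)
  obtain ⟨p, hp, -⟩ := exists_isMinimalProjection_le M hq
    (mul_mem (mul_mem (star_mem hx) hx) hy) fun hc => hx0 (star_mul_self_eq_zero' (by
      rw [← hqh, hc, zero_mul]))
  exact ⟨p, hp⟩

/-- A scalar `c` for which `c • q` is of the form `x* x` is nonnegative. -/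
theorem nonneg_of_star_mul_self_eq_smul {q x : A} (hq : IsStarProjection q) (hq0 : q ≠ 0) {c : ℂ}
    (h : star x * x = c • q) : ∃ t : ℝ, 0 ≤ t ∧ c = t := by
  let := CStarAlgebra.spectralOrder A
  have := CStarAlgebra.spectralOrderedRing A
  have hc : star c = c := by
    have h1 : star (star x * x) = star x * x := by simp
    rw [h, star_smul, hq.isSelfAdjoint.star_eq] at h1
    exact smul_left_injective ℂ hq0 h1
  obtain ⟨t, ht⟩ : ∃ t : ℝ, c = t := ⟨c.re, (Complex.conj_eq_iff_re.1 hc).symm⟩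
  refine ⟨t, ?_, ht⟩
  by_contra hneg
  push Not at hneg
  have h1 : 0 ≤ c • q := h ▸ star_mul_self_nonneg x
  have h2 : 0 ≤ (-c) • q := by
    have : star (((√(-t) : ℝ) : ℂ) • q) * (((√(-t) : ℝ) : ℂ) • q) = (-c) • q := by
      rw [star_smul, hq.isSelfAdjoint.star_eq, smul_mul_smul_comm, hq.isIdempotentElem.eq]
      congr 1
      simp only [Complex.star_def, Complex.conj_ofReal]
      rw [← Complex.ofReal_mul, Real.mul_self_sqrt (by linarith), ht]
      push_cast; ring
    exact this ▸ star_mul_self_nonneg _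
  rw [neg_smul, neg_nonneg] at h2
  have h3 : c • q = 0 := le_antisymm h2 h1
  rcases smul_eq_zero.1 h3 with h4 | h4
  · rw [ht] at h4
    norm_cast at h4
    linarith
  · exact hq0 h4

/-- Murray-von Neumann equivalence inside `M`. -/
def IsEquivalentIn (M : NonUnitalStarSubalgebra ℂ A) (p q : A) : Prop :=
  ∃ w ∈ M, w * star w = p ∧ star w * w = q

theorem mul_eq_self_of_star_mul_self {w p : A} (hp : p * p = p) (h : star w * w = p) :
    w * p = w := by
  have hsp : star p = p := by rw [← h]; simp
  refine sub_eq_zero.1 (star_mul_self_eq_zero' ?_)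
  rw [star_sub, star_mul, hsp, sub_mul, mul_sub, mul_sub, h, mul_assoc p, ← mul_assoc (star w), h,
    mul_assoc p, h, hp, hp, sub_self]

theorem mul_eq_self_of_mul_star_self {w p : A} (hp : p * p = p) (h : w * star w = p) :
    p * w = w := by
  have := mul_eq_self_of_star_mul_self (w := star w) hp (by simpa using h)
  have h2 := congrArg star this
  have hsp : star p = p := by rw [← h]; simp
  rwa [star_mul, star_star, hsp] at h2

/-- Two minimal projections which are connected by a nonzero element are equivalent. -/
theorem IsMinimalProjection.isEquivalentIn {M : NonUnitalStarSubalgebra ℂ A} {p q : A}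
    (hp : IsMinimalProjection M p) (hq : IsMinimalProjection M q) {x : A} (hx : x ∈ M)
    (h0 : p * x * q ≠ 0) : IsEquivalentIn M p q := by
  set y := p * x * q with hy
  have hyM : y ∈ M := mul_mem (mul_mem hp.mem hx) hq.mem
  have hpy : p * y = y := by rw [hy, ← mul_assoc, ← mul_assoc, hp.mul_self]
  have hyq : y * q = y := by rw [hy, mul_assoc, hq.mul_self]
  obtain ⟨c, hc⟩ := hq.compress _ (mul_mem (star_mem hyM) hyM)
  obtain ⟨c', hc'⟩ := hp.compress _ (mul_mem hyM (star_mem hyM))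
  have hqy : q * star y = star y := by
    have := congrArg star hyq
    rwa [star_mul, hq.star_eq] at this
  have hyp : star y * p = star y := by
    have := congrArg star hpy
    rwa [star_mul, hp.star_eq] at this
  clear_value y
  have h1 : star y * y = c • q := by rw [← hc, mul_assoc, mul_assoc, hyq, ← mul_assoc, hqy]
  have h2 : y * star y = c' • p := by rw [← hc', mul_assoc, mul_assoc, hyp, ← mul_assoc, hpy]
  have hcc : c = c' := by
    have : y * star y * y = y * (star y * y) := mul_assoc _ _ _
    rw [h1, h2, smul_mul_assoc, hpy, mul_smul_comm, hyq] at this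
    exact (smul_left_injective ℂ h0 this).symm
  obtain ⟨t, ht, rfl⟩ := nonneg_of_star_mul_self_eq_smul hq.isStarProjection hq.ne_zero h1
  have ht0 : t ≠ 0 := by
    rintro rfl
    exact h0 (star_mul_self_eq_zero' (by simpa using h1))
  have hs : (star (((√t : ℝ) : ℂ)⁻¹) * ((√t : ℝ) : ℂ)⁻¹ * (t : ℂ)) = 1 := by
    rw [star_inv₀, Complex.star_def, Complex.conj_ofReal, ← mul_inv, ← Complex.ofReal_mul,
      Real.mul_self_sqrt ht]
    exact inv_mul_cancel₀ (by exact_mod_cast ht0)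
  refine ⟨((√t : ℝ) : ℂ)⁻¹ • y, SMulMemClass.smul_mem _ hyM, ?_, ?_⟩
  · rw [star_smul, smul_mul_smul_comm, h2, ← hcc, smul_smul,
      mul_comm (((√t : ℝ) : ℂ)⁻¹), hs, one_smul]
  · rw [star_smul, smul_mul_smul_comm, h1, smul_smul, hs, one_smul]

end MinimalProjections

/-! ### Orthogonal families of partial isometries -/

section Families

variable {A : Type*} [NonUnitalCStarAlgebra A]

/-- The elements `w l` are partial isometries with initial projections `p l` and with mutually
orthogonal ranges. -/
structure IsOrthogonalFamily {L : Type*} (w p : L → A) : Prop where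
  initial : ∀ l, star (w l) * w l = p l
  orthogonal : ∀ l k, l ≠ k → star (w l) * w k = 0

namespace IsOrthogonalFamily

variable {L : Type*} {w p : L → A}

theorem mul_right (h : IsOrthogonalFamily w p) (hp : ∀ l, p l * p l = p l) (l : L) :
    w l * p l = w l :=
  mul_eq_self_of_star_mul_self (hp l) (h.initial l)

theorem star_right (h : IsOrthogonalFamily w p) (hp : ∀ l, p l * p l = p l) (l : L) :
    p l * star (w l) = star (w l) := by
  have hs : star (p l) = p l := by rw [← h.initial]; simp
  rw [← hs, ← star_mul, h.mul_right hp]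

theorem sum_mul [Fintype L] (h : IsOrthogonalFamily w p) (hp : ∀ l, p l * p l = p l) (k : L) :
    (∑ l, w l * star (w l)) * w k = w k := by
  rw [Finset.sum_mul, Finset.sum_eq_single k, mul_assoc, h.initial, h.mul_right hp]
  · intro l _ hl
    rw [mul_assoc, h.orthogonal _ _ hl, mul_zero]
  · simp

theorem isStarProjection_sum [Fintype L] (h : IsOrthogonalFamily w p)
    (hp : ∀ l, p l * p l = p l) : IsStarProjection (∑ l, w l * star (w l)) where
  isIdempotentElem := by
    change _ * _ = _
    rw [Finset.mul_sum]
    exact Finset.sum_congr rfl fun l _ => by rw [← mul_assoc, h.sum_mul hp]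
  isSelfAdjoint := by
    change star _ = _
    simp [star_sum]

/-- Composition of families: `w` is refined by families below its initial projections. -/
theorem comp {K J : Type*} {v q : K → A} (h : IsOrthogonalFamily w p) (hv : IsOrthogonalFamily v q)
    (f : J → L) (g : J → K) (hfg : Function.Injective fun j => (f j, g j))
    (hpv : ∀ j, p (f j) * v (g j) = v (g j)) :
    IsOrthogonalFamily (fun j => w (f j) * v (g j)) (fun j => q (g j)) where
  initial j := by
    rw [star_mul, mul_assoc, ← mul_assoc (star (w _)), h.initial, hpv,
      hv.initial]
  orthogonal i j hij := by
    rw [star_mul, mul_assoc, ← mul_assoc (star (w _))]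
    by_cases hf : f i = f j
    · have hg : g i ≠ g j := fun hg => hij (hfg (Prod.ext hf hg))
      rw [hf, h.initial, hpv, hv.orthogonal _ _ hg]
    · rw [h.orthogonal _ _ hf, zero_mul, mul_zero]

end IsOrthogonalFamily

/-- A complete set of representatives for the equivalence classes of minimal projections. -/
structure IsRepresentatives (M : NonUnitalStarSubalgebra ℂ A) {V : Type*} (p : V → A) : Prop where
  isMinimalProjection : ∀ v, IsMinimalProjection M (p v)
  compress_eq_zero : ∀ v w, v ≠ w → ∀ x ∈ M, p v * x * p w = 0
  exists_equiv : ∀ q, IsMinimalProjection M q → ∃ v, IsEquivalentIn M q (p v)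

theorem isEquivalentIn_equivalence (M : NonUnitalStarSubalgebra ℂ A) :
    Equivalence fun p q : {p // IsMinimalProjection M p} => IsEquivalentIn M p.1 q.1 where
  refl p := ⟨p, p.2.mem, by rw [p.2.star_eq, p.2.mul_self], by rw [p.2.star_eq, p.2.mul_self]⟩
  symm := by
    rintro p q ⟨w, hw, h1, h2⟩
    exact ⟨star w, star_mem hw, by rw [star_star, h2], by rw [star_star, h1]⟩
  trans := by
    rintro p q r ⟨w, hw, h1, h2⟩ ⟨v, hv, h3, h4⟩
    refine ⟨w * v, mul_mem hw hv, ?_, ?_⟩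
    · rw [star_mul, mul_assoc, ← mul_assoc v, h3, ← mul_assoc,
        mul_eq_self_of_star_mul_self q.2.mul_self h2, h1]
    · rw [star_mul, mul_assoc, ← mul_assoc (star w), h2,
        mul_eq_self_of_mul_star_self q.2.mul_self h3, h4]

theorem exists_isRepresentatives (M : NonUnitalStarSubalgebra ℂ A) [FiniteDimensional ℂ M] :
    ∃ (k : ℕ) (p : Fin k → A), IsRepresentatives M p := by
  let s : Setoid {p // IsMinimalProjection M p} := ⟨_, isEquivalentIn_equivalence M⟩
  let f : Quotient s → M := fun v => ⟨v.out.1, v.out.2.mem⟩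
  have hf : ∀ v w : Quotient s, v ≠ w → ∀ x ∈ M, v.out.1 * x * w.out.1 = 0 := by
    intro v w hvw x hx
    by_contra h
    apply hvw
    rw [← v.out_eq, ← w.out_eq]
    exact Quotient.sound (v.out.2.isEquivalentIn w.out.2 hx h)
  have hli : LinearIndependent ℂ f := by
    rw [linearIndependent_iff']
    intro t g hg v hv
    have h1 : ∑ w ∈ t, g w • w.out.1 = 0 := by
      have := congrArg (Subtype.val : M → A) hg
      simpa [f] using this
    have h2 := congrArg (fun y => v.out.1 * y) h1
    simp only [Finset.mul_sum, mul_zero, mul_smul_comm] at h2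
    rw [Finset.sum_eq_single v, v.out.2.mul_self] at h2
    · exact (smul_eq_zero.1 h2).resolve_right v.out.2.ne_zero
    · intro w _ hw
      have := hf v w hw.symm v.out.1 v.out.2.mem
      rw [v.out.2.mul_self] at this
      rw [this, smul_zero]
    · exact fun h => absurd hv h
  have hfin : Finite (Quotient s) := hli.finite
  obtain ⟨k, ⟨e⟩⟩ := Finite.exists_equiv_fin (Quotient s)
  refine ⟨k, fun i => (e.symm i).out.1, fun i => (e.symm i).out.2, fun i j hij =>
    hf _ _ (e.symm.injective.ne hij), fun q hq => ⟨e ⟦⟨q, hq⟩⟧, ?_⟩⟩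
  rw [e.symm_apply_apply]
  exact Setoid.symm (Quotient.mk_out (s := s) ⟨q, hq⟩)

/-- Every projection of `M` is a finite orthogonal sum of projections equivalent to the chosen
representatives of the minimal projections. -/
theorem IsRepresentatives.exists_decomposition {M : NonUnitalStarSubalgebra ℂ A}
    [FiniteDimensional ℂ M] {V : Type*} {p : V → A} (hp : IsRepresentatives M p) {e : A}
    (he : IsStarProjection e) (heM : e ∈ M) :
    ∃ (n : ℕ) (w : Fin n → A) (t : Fin n → V), (∀ l, w l ∈ M) ∧
      IsOrthogonalFamily w (fun l => p (t l)) ∧ ∑ l, w l * star (w l) = e := by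
  induction hk : Module.finrank ℂ (corner M e) using Nat.strong_induction_on generalizing e with
  | _ k ih =>
    by_cases he0 : e = 0
    · refine ⟨0, Fin.elim0, Fin.elim0, fun l => l.elim0, ⟨fun l => l.elim0, fun l => l.elim0⟩, ?_⟩
      simp [he0]
    obtain ⟨q, hq, heq⟩ := exists_isMinimalProjection_le M he heM he0
    obtain ⟨v, w₀, hw₀, h1, h2⟩ := hp.exists_equiv q hq
    have hqe : q * e = q := by
      have := congrArg star heq
      rwa [star_mul, he.isSelfAdjoint.star_eq, hq.star_eq] at this
    have hf : IsStarProjection (e - q) := by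
      refine ⟨?_, ?_⟩
      · change (e - q) * (e - q) = e - q
        rw [sub_mul, mul_sub, mul_sub, he.isIdempotentElem.eq, heq, hqe, hq.mul_self]
        abel
      · change star (e - q) = e - q
        rw [star_sub, he.isSelfAdjoint.star_eq, hq.star_eq]
    have hfe : e * (e - q) = e - q := by rw [mul_sub, he.isIdempotentElem.eq, heq]
    have hne : e - q ≠ e := fun h => hq.ne_zero (by simpa using h)
    obtain ⟨n, w, t, hw, hfam, hsum⟩ :=
      ih _ (hk ▸ finrank_corner_lt he heM hf hfe hne) hf (sub_mem heM hq.mem) rfl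
    have hqw : ∀ l, q * w l = 0 := fun l => by
      rw [← hfam.sum_mul (fun l => (hp.isMinimalProjection _).mul_self) l, hsum, ← mul_assoc,
        mul_sub, hqe, hq.mul_self, sub_self, zero_mul]
    have hw0 : q * w₀ = w₀ := mul_eq_self_of_mul_star_self hq.mul_self h1
    have hcross : ∀ l, star w₀ * w l = 0 := fun l => by
      rw [← hw0, star_mul, hq.star_eq, mul_assoc, hqw, mul_zero]
    refine ⟨n + 1, Fin.cons w₀ w, Fin.cons v t, ?_, ⟨?_, ?_⟩, ?_⟩
    · exact Fin.cases hw₀ hw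
    · exact Fin.cases h2 hfam.initial
    · refine Fin.cases (Fin.cases (fun h => absurd rfl h) fun l _ => hcross l)
        fun l => Fin.cases (fun _ => ?_) fun k h => ?_
      · have := congrArg star (hcross l)
        simpa using this
      · exact hfam.orthogonal l k fun h' => h (by rw [h'])
    · rw [Fin.sum_univ_succ]
      simp only [Fin.cons_zero, Fin.cons_succ, hsum, h1]
      abel

end Families

/-! ### Systems of matrix units of a finite-dimensional C*-algebra -/

section Frames

/-- A linear functional which takes the value `1` at `p`, provided that `p ≠ 0`. -/
noncomputable def dualCoordinate {A : Type*} [NonUnitalCStarAlgebra A] (p : A) : A →ₗ[ℂ] ℂ :=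
  open Classical in
  if hp : p ≠ 0 then ((SeparatingDual.exists_eq_one (R := ℂ) hp).choose : A →ₗ[ℂ] ℂ) else 0

theorem dualCoordinate_smul {A : Type*} [NonUnitalCStarAlgebra A] {p : A} (hp : p ≠ 0) (c : ℂ) :
    dualCoordinate p (c • p) = c := by
  have h := (SeparatingDual.exists_eq_one (R := ℂ) hp).choose_spec
  simp [dualCoordinate, hp, h]

variable {A B : Type*} [CStarAlgebra A] [NonUnitalCStarAlgebra B]

/-- The coefficient of `u i * star (u j)` in an element, see `IsFrame.sum_coeff_smul`. -/
noncomputable def coeff {V I : Type*} (p : V → A) (r : I → V) (u : I → A) (i j : I) :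
    A →ₗ[ℂ] ℂ :=
  dualCoordinate (p (r i)) ∘ₗ LinearMap.mulLeft ℂ (star (u i)) ∘ₗ LinearMap.mulRight ℂ (u j)

/-- A system of matrix units of a finite-dimensional unital C*-algebra `M`. The vertices `v : V`
stand for the simple summands of `M`, and `p v` is a minimal projection of the summand `v`. For an
index `i : I`, which belongs to the summand `r i`, the element `u i` is a partial isometry with
initial projection `p (r i)`, and the final projections of the `u i` add up to `1`. Thus the
elements `u i * star (u j)` with `r i = r j` are matrix units of `M`. -/
structure IsFrame (M : NonUnitalStarSubalgebra ℂ A) {V I : Type*} [Fintype I]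
    (p : V → A) (r : I → V) (u : I → A) : Prop where
  minimal : ∀ v, IsMinimalProjection M (p v)
  compress_eq_zero : ∀ v w, v ≠ w → ∀ x ∈ M, p v * x * p w = 0
  mem : ∀ i, u i ∈ M
  family : IsOrthogonalFamily u (fun i => p (r i))
  sum : ∑ i, u i * star (u i) = 1

/-- The linear map which replaces the matrix units `u i * star (u j)` by `U i * star (U j)`. -/
noncomputable def frameMap {V I : Type*} [Fintype I] (p : V → A) (r : I → V) (u : I → A)
    (U : I → B) : A →ₗ[ℂ] B :=
  ∑ i, ∑ j, (coeff p r u i j).smulRight (U i * star (U j))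

theorem frameMap_apply {V I : Type*} [Fintype I] (p : V → A) (r : I → V) (u : I → A)
    (U : I → B) (a : A) :
    frameMap p r u U a = ∑ i, ∑ j, coeff p r u i j a • (U i * star (U j)) := by
  simp [frameMap]

theorem coeff_eq_of_compress {V I : Type*} {p : V → A} {r : I → V} {u : I → A} {a : A} {i j : I}
    {c : ℂ} (hp : p (r i) ≠ 0) (h : star (u i) * a * u j = c • p (r i)) :
    coeff p r u i j a = c := by
  simp [coeff, ← mul_assoc, h, dualCoordinate_smul hp, -map_smul]

/-- A linear map which is multiplicative, `*`-preserving and injective on a finite-dimensional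
`*`-subalgebra is isometric there. -/
theorem norm_map_eq_of_injOn {A B : Type*} [NonUnitalCStarAlgebra A] [NonUnitalCStarAlgebra B]
    {M : NonUnitalStarSubalgebra ℂ A} [FiniteDimensional ℂ M]
    {T : A →ₗ[ℂ] B} (hmul : ∀ a ∈ M, ∀ b ∈ M, T (a * b) = T a * T b)
    (hstar : ∀ a ∈ M, T (star a) = star (T a)) (hinj : ∀ a ∈ M, T a = 0 → a = 0) {a : A}
    (ha : a ∈ M) : ‖T a‖ = ‖a‖ := by
  have hfd : FiniteDimensional ℂ M.toSubmodule := ‹FiniteDimensional ℂ M›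
  have hcl : IsClosed (M : Set A) := M.toSubmodule.closed_of_finiteDimensional
  let φ : M →⋆ₙₐ[ℂ] B :=
    { toFun := fun x => T x
      map_smul' := fun c x => T.map_smul c x
      map_zero' := T.map_zero
      map_add' := fun x y => T.map_add x y
      map_mul' := fun x y => hmul x x.2 y y.2
      map_star' := fun x => hstar x x.2 }
  have hφ : Function.Injective φ := by
    rw [injective_iff_map_eq_zero]
    exact fun x hx => Subtype.ext (hinj x x.2 hx)
  exact NonUnitalStarAlgHom.norm_map φ hφ ⟨a, ha⟩

section Family

variable {I : Type*} [Fintype I] {U : I → B} {P : B}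

theorem IsOrthogonalFamily.compress_sum (hU : IsOrthogonalFamily U fun _ => P) (hP : P * P = P)
    (c : I → I → ℂ) (i j : I) :
    star (U i) * (∑ k, ∑ l, c k l • (U k * star (U l))) * U j = c i j • P := by
  have h1 : ∀ k l, star (U i) * (U k * star (U l)) * U j =
      (star (U i) * U k) * (star (U l) * U j) := fun k l => by simp only [mul_assoc]
  rw [Finset.mul_sum, Finset.sum_mul, Finset.sum_eq_single i, Finset.mul_sum, Finset.sum_mul,
    Finset.sum_eq_single j]
  · rw [mul_smul_comm, smul_mul_assoc, h1, hU.initial, hU.initial, hP]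
  · intro l _ hl
    rw [mul_smul_comm, smul_mul_assoc, h1, hU.orthogonal l j hl, mul_zero, smul_zero]
  · simp
  · intro k _ hk
    rw [Finset.mul_sum, Finset.sum_mul]
    exact Finset.sum_eq_zero fun l _ => by
      rw [mul_smul_comm, smul_mul_assoc, h1, hU.orthogonal i k hk.symm, zero_mul, smul_zero]
  · simp

theorem IsOrthogonalFamily.compress_eq (hU : IsOrthogonalFamily U fun _ => P) (hP : P * P = P)
    {y : B} {c : I → I → ℂ} (h : ∀ i j, star (U i) * y * U j = c i j • P) :
    (∑ i, U i * star (U i)) * y * (∑ i, U i * star (U i)) =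
      ∑ i, ∑ j, c i j • (U i * star (U j)) := by
  rw [Finset.sum_mul, Finset.sum_mul]
  refine Finset.sum_congr rfl fun i _ => ?_
  rw [Finset.mul_sum]
  refine Finset.sum_congr rfl fun j _ => ?_
  have : U i * star (U i) * y * (U j * star (U j)) =
      U i * (star (U i) * y * U j) * star (U j) := by simp only [mul_assoc]
  rw [this, h, mul_smul_comm, smul_mul_assoc, hU.mul_right (fun _ => hP)]

end Family

namespace IsFrame

variable {M : NonUnitalStarSubalgebra ℂ A} {V I : Type*} [Fintype I] {p : V → A} {r : I → V}
  {u : I → A}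

theorem mul_right (h : IsFrame M p r u) (i : I) : u i * p (r i) = u i :=
  h.family.mul_right (fun i => (h.minimal (r i)).mul_self) i

theorem star_right (h : IsFrame M p r u) (i : I) : p (r i) * star (u i) = star (u i) :=
  h.family.star_right (fun i => (h.minimal (r i)).mul_self) i

theorem mul_eq_zero (h : IsFrame M p r u) {v w : V} (hvw : v ≠ w) : p v * p w = 0 := by
  have := h.compress_eq_zero v w hvw (p v) (h.minimal v).mem
  rwa [(h.minimal v).mul_self] at this

theorem compress_of_ne (h : IsFrame M p r u) {a : A} (ha : a ∈ M) {i j : I} (hij : r i ≠ r j) :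
    star (u i) * a * u j = 0 := by
  rw [← h.star_right, ← h.mul_right j]
  have := h.compress_eq_zero _ _ hij (star (u i) * a * u j)
    (mul_mem (mul_mem (star_mem (h.mem i)) ha) (h.mem j))
  simpa only [mul_assoc] using this

theorem compress (h : IsFrame M p r u) {a : A} (ha : a ∈ M) (i j : I) :
    star (u i) * a * u j = coeff p r u i j a • p (r i) := by
  suffices ∃ c : ℂ, star (u i) * a * u j = c • p (r i) by
    obtain ⟨c, hc⟩ := this
    rw [hc, coeff_eq_of_compress (h.minimal _).ne_zero hc]
  by_cases hij : r i = r j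
  · obtain ⟨c, hc⟩ := (h.minimal (r i)).compress (star (u i) * a * u j)
      (mul_mem (mul_mem (star_mem (h.mem i)) ha) (h.mem j))
    refine ⟨c, ?_⟩
    rw [← hc, ← mul_assoc, ← mul_assoc, h.star_right, mul_assoc _ (u j), hij, h.mul_right]
  · exact ⟨0, by rw [h.compress_of_ne ha hij, zero_smul]⟩

theorem coeff_of_ne (h : IsFrame M p r u) {a : A} (ha : a ∈ M) {i j : I} (hij : r i ≠ r j) :
    coeff p r u i j a = 0 :=
  coeff_eq_of_compress (h.minimal _).ne_zero (by rw [h.compress_of_ne ha hij, zero_smul])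

theorem sum_coeff_smul (h : IsFrame M p r u) {a : A} (ha : a ∈ M) :
    ∑ i, ∑ j, coeff p r u i j a • (u i * star (u j)) = a := by
  calc _ = (∑ i, u i * star (u i)) * a * (∑ j, u j * star (u j)) := by
        rw [Finset.sum_mul, Finset.sum_mul]
        refine Finset.sum_congr rfl fun i _ => ?_
        rw [Finset.mul_sum]
        refine Finset.sum_congr rfl fun j _ => ?_
        have : u i * star (u i) * a * (u j * star (u j)) =
          u i * (star (u i) * a * u j) * star (u j) := by simp only [mul_assoc]
        rw [this, h.compress ha, mul_smul_comm, smul_mul_assoc, h.mul_right]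
    _ = a := by rw [h.sum, one_mul, mul_one]

theorem sum_mem (h : IsFrame M p r u) (c : I → I → ℂ) :
    ∑ i, ∑ j, c i j • (u i * star (u j)) ∈ M :=
  _root_.sum_mem fun i _ => _root_.sum_mem fun j _ =>
    SMulMemClass.smul_mem _ (mul_mem (h.mem i) (star_mem (h.mem j)))

theorem coeff_sum (h : IsFrame M p r u) (c : I → I → ℂ) {i j : I} (hij : r i = r j) :
    coeff p r u i j (∑ i, ∑ j, c i j • (u i * star (u j))) = c i j := by
  refine coeff_eq_of_compress (h.minimal _).ne_zero ?_
  have h1 : ∀ k l, star (u i) * (u k * star (u l)) * u j =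
      (star (u i) * u k) * (star (u l) * u j) := fun k l => by simp only [mul_assoc]
  rw [Finset.mul_sum, Finset.sum_mul, Finset.sum_eq_single i, Finset.mul_sum, Finset.sum_mul,
    Finset.sum_eq_single j]
  · rw [mul_smul_comm, smul_mul_assoc, h1, h.family.initial, h.family.initial, ← hij,
      (h.minimal _).mul_self]
  · intro l _ hl
    rw [mul_smul_comm, smul_mul_assoc, h1, h.family.orthogonal l j hl, mul_zero, smul_zero]
  · simp
  · intro k _ hk
    rw [Finset.mul_sum, Finset.sum_mul]
    exact Finset.sum_eq_zero fun l _ => by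
      rw [mul_smul_comm, smul_mul_assoc, h1, h.family.orthogonal i k hk.symm, zero_mul, smul_zero]
  · simp

theorem coeff_mul (h : IsFrame M p r u) {a b : A} (ha : a ∈ M) (hb : b ∈ M) (i j : I) :
    coeff p r u i j (a * b) = ∑ k, coeff p r u i k a * coeff p r u k j b := by
  refine coeff_eq_of_compress (h.minimal _).ne_zero ?_
  calc star (u i) * (a * b) * u j
      = star (u i) * a * (∑ k, u k * star (u k)) * (b * u j) := by
        rw [h.sum]; simp only [mul_assoc, one_mul]
    _ = ∑ k, (star (u i) * a * u k) * (star (u k) * b * u j) := by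
        rw [Finset.mul_sum, Finset.sum_mul]
        exact Finset.sum_congr rfl fun k _ => by simp only [mul_assoc]
    _ = _ := by
        rw [Finset.sum_smul]
        refine Finset.sum_congr rfl fun k _ => ?_
        rw [h.compress ha, h.compress hb]
        by_cases hik : r i = r k
        · rw [← hik, smul_mul_smul_comm, (h.minimal _).mul_self]
        · rw [h.coeff_of_ne ha hik]; simp

theorem coeff_star (h : IsFrame M p r u) {a : A} (ha : a ∈ M) (i j : I) :
    coeff p r u i j (star a) = star (coeff p r u j i a) := by
  refine coeff_eq_of_compress (h.minimal _).ne_zero ?_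
  have := congrArg star (h.compress ha j i)
  rw [star_mul, star_mul, star_star, star_smul, (h.minimal _).star_eq, ← mul_assoc] at this
  rw [this]
  by_cases hij : r i = r j
  · rw [hij]
  · rw [h.coeff_of_ne ha (Ne.symm hij)]; simp

variable {U : I → B} {P : B}

theorem frameMap_compress (hU : IsOrthogonalFamily U fun _ => P) (hP : P * P = P)
    (a : A) (i j : I) :
    star (U i) * frameMap p r u U a * U j = coeff p r u i j a • P := by
  rw [frameMap_apply, hU.compress_sum hP (fun i j => coeff p r u i j a)]

theorem frameMap_eq (hU : IsOrthogonalFamily U fun _ => P) (hP : P * P = P) {y : B} {a : A}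
    (hy : ∀ i j, star (U i) * y * U j = coeff p r u i j a • P) :
    (∑ i, U i * star (U i)) * y * (∑ i, U i * star (U i)) = frameMap p r u U a := by
  rw [frameMap_apply, hU.compress_eq hP (c := fun i j => coeff p r u i j a) hy]

theorem frameMap_mul (h : IsFrame M p r u) (hU : IsOrthogonalFamily U fun _ => P) (hP : P * P = P)
    {a b : A} (ha : a ∈ M) (hb : b ∈ M) :
    frameMap p r u U (a * b) = frameMap p r u U a * frameMap p r u U b := by
  have e1 : ∀ c, (∑ i, U i * star (U i)) * frameMap p r u U c * (∑ i, U i * star (U i)) =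
      frameMap p r u U c := fun c => frameMap_eq hU hP (frameMap_compress hU hP c)
  have hq : (∑ i, U i * star (U i)) * (∑ i, U i * star (U i)) = ∑ i, U i * star (U i) :=
    (hU.isStarProjection_sum (fun _ => hP)).isIdempotentElem
  have e2 : ∀ c, (∑ i, U i * star (U i)) * frameMap p r u U c = frameMap p r u U c := fun c => by
    rw [← e1 c, ← mul_assoc, ← mul_assoc, hq]
  have e3 : ∀ c, frameMap p r u U c * (∑ i, U i * star (U i)) = frameMap p r u U c := fun c => by
    rw [← e1 c, mul_assoc, hq]
  rw [← frameMap_eq hU hP (y := frameMap p r u U a * frameMap p r u U b) (a := a * b),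
    ← mul_assoc, e2, mul_assoc, e3]
  intro i j
  calc star (U i) * (frameMap p r u U a * frameMap p r u U b) * U j
      = star (U i) * (frameMap p r u U a * (∑ k, U k * star (U k))) *
          (frameMap p r u U b * U j) := by rw [e3]; simp only [mul_assoc]
    _ = ∑ k, (star (U i) * frameMap p r u U a * U k) *
          (star (U k) * frameMap p r u U b * U j) := by
        rw [Finset.mul_sum, Finset.mul_sum, Finset.sum_mul]
        exact Finset.sum_congr rfl fun k _ => by simp only [mul_assoc]
    _ = _ := by
        rw [h.coeff_mul ha hb, Finset.sum_smul]
        exact Finset.sum_congr rfl fun k _ => by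
          rw [frameMap_compress hU hP, frameMap_compress hU hP, smul_mul_smul_comm, hP]

theorem frameMap_star (h : IsFrame M p r u) {a : A} (ha : a ∈ M) :
    frameMap p r u U (star a) = star (frameMap p r u U a) := by
  simp only [frameMap_apply, star_sum, star_smul, star_mul, star_star, h.coeff_star ha]
  exact Finset.sum_comm

/-- A realisation of the matrix units is a faithful `*`-homomorphism on `M`, hence isometric. -/
theorem norm_frameMap (h : IsFrame M p r u) [FiniteDimensional ℂ M]
    (hU : IsOrthogonalFamily U fun _ => P) (hP : P * P = P) (hP0 : P ≠ 0) {a : A} (ha : a ∈ M) :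
    ‖frameMap p r u U a‖ = ‖a‖ := by
  refine norm_map_eq_of_injOn (M := M) (fun a ha b hb => h.frameMap_mul hU hP ha hb)
    (fun a ha => h.frameMap_star ha) (fun a ha h0 => ?_) ha
  rw [← h.sum_coeff_smul ha]
  refine Finset.sum_eq_zero fun i _ => Finset.sum_eq_zero fun j _ => ?_
  have := frameMap_compress (p := p) (r := r) (u := u) hU hP a i j
  rw [h0, mul_zero, zero_mul] at this
  rw [(smul_eq_zero.1 this.symm).resolve_right hP0, zero_smul]

end IsFrame

end Frames

/-! ### Refinement of matrix units along an inclusion -/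

section Refinement

variable {A B : Type*} [CStarAlgebra A] [NonUnitalCStarAlgebra B]

/-- The matrix units `(p', r', u')` of a larger algebra refine the matrix units `(p, r, u)` of `M`:
an index `x` of the larger system is given by an index `f x` of the smaller one together with an
edge `g x` of the Bratteli diagram of the inclusion, starting at the vertex `r (f x)`. The index
`κ i` prolongs `i` by an edge which only depends on the vertex `r i`. -/
structure IsRefinement (M : NonUnitalStarSubalgebra ℂ A) {V I V' I' L : Type*}
    (p : V → A) (r : I → V) (u : I → A) (p' : V' → A) (r' : I' → V') (u' : I' → A)
    (f : I' → I) (g : I' → L) (κ : I → I') : Prop where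
  injective : Function.Injective fun x => (f x, g x)
  f_section : ∀ i, f (κ i) = i
  g_section : ∀ i j, g (κ i) = g (κ j) ↔ r i = r j
  r_eq : ∀ x y, g x = g y → r (f x) = r (f y)
  coeff_eq : ∀ a ∈ M, ∀ x y, g x = g y → coeff p' r' u' x y a = coeff p r u (f x) (f y) a
  coeff_eq_zero : ∀ a ∈ M, ∀ x y, g x ≠ g y → coeff p' r' u' x y a = 0

/-- Matrix units of `M` can be refined along an inclusion `M ≤ M'`: each minimal projection `p v` is
decomposed into minimal projections of `M'`, and `u i` is multiplied by the pieces of `p (r i)`. -/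
theorem IsFrame.exists_refinement {M M' : NonUnitalStarSubalgebra ℂ A} (hM : M ≤ M')
    [FiniteDimensional ℂ M'] {V I : Type} [Fintype V] [Fintype I] {p : V → A} {r : I → V}
    {u : I → A} (h : IsFrame M p r u) :
    ∃ (V' I' L : Type) (_ : Fintype V') (_ : Fintype I') (_ : Fintype L) (p' : V' → A)
      (r' : I' → V') (u' : I' → A) (f : I' → I) (g : I' → L) (κ : I → I'),
      IsFrame M' p' r' u' ∧ IsRefinement M p r u p' r' u' f g κ := by
  obtain ⟨k, p', hp'⟩ := exists_isRepresentatives M'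
  choose n w t hw hfam hsum using fun v =>
    hp'.exists_decomposition (h.minimal v).isStarProjection (hM (h.minimal v).mem)
  have hpp' : ∀ v, p' v * p' v = p' v := fun v => (hp'.isMinimalProjection v).mul_self
  have hpw : ∀ v l, p v * w v l = w v l := fun v l => by
    rw [← hsum v]; exact (hfam v).sum_mul (fun _ => hpp' _) l
  have hn : ∀ v, 0 < n v := fun v => by
    refine Nat.pos_of_ne_zero fun h0 => (h.minimal v).ne_zero ?_
    rw [← hsum v]
    have : IsEmpty (Fin (n v)) := by rw [h0]; infer_instance
    simp
  let W : (Σ v, Fin (n v)) → A := fun x => w x.1 x.2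
  have hW : IsOrthogonalFamily W (fun x => p' (t x.1 x.2)) := by
    refine ⟨fun x => (hfam x.1).initial x.2, ?_⟩
    rintro ⟨v, l⟩ ⟨v', l'⟩ hne
    by_cases hv : v = v'
    · subst hv
      exact (hfam v).orthogonal l l' fun hl => hne (by rw [hl])
    · change star (w v l) * w v' l' = 0
      rw [← hpw v l, ← hpw v' l', star_mul, (h.minimal v).star_eq, mul_assoc, ← mul_assoc (p v),
        h.mul_eq_zero hv, zero_mul, mul_zero]
  let I' := Σ i, Fin (n (r i))
  let f : I' → I := Sigma.fst
  let g : I' → (Σ v, Fin (n v)) := fun x => ⟨r x.1, x.2⟩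
  have hinj : Function.Injective fun x => (f x, g x) := by
    rintro ⟨i, l⟩ ⟨i', l'⟩ hx
    obtain ⟨h1, h2⟩ := Prod.ext_iff.1 hx
    change i = i' at h1
    subst h1
    have h3 : l = l' := by simpa [g] using h2
    rw [h3]
  let u' : I' → A := fun x => u (f x) * W (g x)
  let r' : I' → Fin k := fun x => t (g x).1 (g x).2
  have hu' : IsOrthogonalFamily u' (fun x => p' (r' x)) :=
    h.family.comp hW f g hinj fun x => hpw _ _
  have hcomp : ∀ a ∈ M, ∀ x y, star (u' x) * a * u' y =
      coeff p r u (f x) (f y) a • (star (W (g x)) * W (g y)) := fun a ha x y => by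
    have h1 : star (u' x) * a * u' y =
        star (W (g x)) * (star (u (f x)) * a * u (f y)) * W (g y) := by
      simp only [u', star_mul, mul_assoc]
    rw [h1, h.compress ha, mul_smul_comm, smul_mul_assoc, mul_assoc]
    by_cases hr : r (f x) = r (f y)
    · rw [hr, hpw]
    · rw [h.coeff_of_ne ha hr, zero_smul, zero_smul]
  have hframe : IsFrame M' p' r' u' :=
    { minimal := hp'.isMinimalProjection
      compress_eq_zero := hp'.compress_eq_zero
      mem := fun x => mul_mem (hM (h.mem _)) (hw _ _)
      family := hu'
      sum := by
        rw [Fintype.sum_sigma, ← h.sum]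
        refine Finset.sum_congr rfl fun i _ => ?_
        have h1 : ∀ l, u' ⟨i, l⟩ * star (u' ⟨i, l⟩) =
            u i * (w (r i) l * star (w (r i) l)) * star (u i) := fun l => by
          simp only [u', f, g, W, star_mul, mul_assoc]
        simp only [h1]
        rw [← Finset.sum_mul, ← Finset.mul_sum, hsum, h.mul_right] }
  let σ : V → (Σ v, Fin (n v)) := fun v => ⟨v, ⟨0, hn v⟩⟩
  refine ⟨Fin k, I', Σ v, Fin (n v), inferInstance, inferInstance, inferInstance, p', r', u', f, g,
    fun i => ⟨i, ⟨0, hn _⟩⟩, hframe, hinj, fun i => rfl, fun i j => ⟨fun hij => ?_, fun hij => ?_⟩,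
    fun x y hxy => congrArg Sigma.fst hxy, fun a ha x y hxy => ?_, fun a ha x y hxy => ?_⟩
  · exact congrArg Sigma.fst hij
  · exact congrArg σ hij
  · refine coeff_eq_of_compress (hframe.minimal _).ne_zero ?_
    rw [hcomp a ha, ← hxy, hW.initial]
  · refine coeff_eq_of_compress (hframe.minimal _).ne_zero ?_
    rw [hcomp a ha, hW.orthogonal _ _ hxy, smul_zero, zero_smul]

/-- The projections of the larger system which belong to the indices `κ i` commute with `M`, and
compressing to them and to the block diagonal gives a projection of the larger algebra onto `M`.
It is contractive because, after a suitable replacement of the matrix units, it becomes the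
compression to a projection: partial isometries `G v` with orthogonal ranges, one for each vertex
`v`, separate the blocks. -/
theorem IsFrame.exists_contractive_projection {M M' : NonUnitalStarSubalgebra ℂ A}
    [FiniteDimensional ℂ M] [FiniteDimensional ℂ M']
    {V I V' I' L : Type*} [Fintype I] [Fintype I'] {p : V → A} {r : I → V}
    {u : I → A} (h : IsFrame M p r u) {p' : V' → A} {r' : I' → V'} {u' : I' → A}
    (h' : IsFrame M' p' r' u') {f : I' → I} {g : I' → L} {κ : I → I'}
    (hf : IsRefinement M p r u p' r' u' f g κ)
    {U : I' → B} {P P' : B} (hU : IsOrthogonalFamily U fun _ => P) (hP : P * P = P) (hP0 : P ≠ 0)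
    {G : V → B} (hG : IsOrthogonalFamily G fun _ => P') (hP' : P' * P' = P') (hP'0 : P' ≠ 0)
    (hPG : ∀ v, P * G v = G v) :
    ∃ E : A →ₗ[ℂ] A, (∀ x ∈ M', E x ∈ M ∧ ‖E x‖ ≤ ‖x‖) ∧ ∀ x ∈ M, E x = x := by
  let E : A →ₗ[ℂ] A :=
    ∑ i, ∑ j, (coeff p' r' u' (κ i) (κ j)).smulRight (u i * star (u j))
  have hE : ∀ x, E x = ∑ i, ∑ j, coeff p' r' u' (κ i) (κ j) x • (u i * star (u j)) :=
    fun x => by simp [E]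
  have hEM : ∀ x, E x ∈ M := fun x => by rw [hE]; exact h.sum_mem _
  refine ⟨E, fun x hx => ⟨hEM x, ?_⟩, fun x hx => ?_⟩
  · let U'' : I → B := fun i => U (κ i) * G (r i)
    have hκ : Function.Injective κ := fun i j hij => by
      rw [← hf.f_section i, hij, hf.f_section]
    have hU'' : IsOrthogonalFamily U'' fun _ => P' :=
      hU.comp hG κ r (fun i j hij => hκ (Prod.ext_iff.1 hij).1) fun i => hPG _
    have hkey : (∑ i, U'' i * star (U'' i)) * frameMap p' r' u' U x * (∑ i, U'' i * star (U'' i)) =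
        frameMap p r u U'' (E x) := by
      refine IsFrame.frameMap_eq hU'' hP' fun i j => ?_
      have h1 : star (U'' i) * frameMap p' r' u' U x * U'' j =
          star (G (r i)) * (star (U (κ i)) * frameMap p' r' u' U x * U (κ j)) * G (r j) := by
        simp only [U'', star_mul, mul_assoc]
      rw [h1, IsFrame.frameMap_compress hU hP, mul_smul_comm, smul_mul_assoc, mul_assoc, hPG]
      by_cases hij : r i = r j
      · rw [← hij, hG.initial, hE, h.coeff_sum (fun i j => coeff p' r' u' (κ i) (κ j) x) hij]
      · rw [hG.orthogonal _ _ hij, h.coeff_of_ne (hEM x) hij, smul_zero, zero_smul]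
    have hQ : ‖∑ i, U'' i * star (U'' i)‖ ≤ 1 :=
      (hU''.isStarProjection_sum fun _ => hP').norm_le
    rw [← h.norm_frameMap hU'' hP' hP'0 (hEM x), ← hkey, ← h'.norm_frameMap hU hP hP0 hx]
    calc _ ≤ ‖∑ i, U'' i * star (U'' i)‖ * ‖frameMap p' r' u' U x‖ *
          ‖∑ i, U'' i * star (U'' i)‖ :=
          (norm_mul_le _ _).trans (mul_le_mul_of_nonneg_right (norm_mul_le _ _) (norm_nonneg _))
      _ ≤ 1 * ‖frameMap p' r' u' U x‖ * 1 := by gcongr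
      _ = _ := by ring
  · rw [hE]
    conv_rhs => rw [← h.sum_coeff_smul hx]
    refine Finset.sum_congr rfl fun i _ => Finset.sum_congr rfl fun j _ => ?_
    by_cases hij : r i = r j
    · rw [hf.coeff_eq x hx _ _ ((hf.g_section i j).2 hij), hf.f_section, hf.f_section]
    · rw [hf.coeff_eq_zero x hx _ _ (fun hg => hij ((hf.g_section i j).1 hg)),
        h.coeff_of_ne hx hij]

/-- The refined matrix units of `M'` are realised in `B` by refining the partial isometries `U`
by means of partial isometries `G`, indexed by the edges, below the common initial projection `P` of
the `U`. The compression to the new support is then compatible with the two realisations. -/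
theorem IsRefinement.compress_eq_frameMap {M : NonUnitalStarSubalgebra ℂ A}
    {V I V' I' L : Type*} [Fintype I] [Fintype I'] {p : V → A} {r : I → V}
    {u : I → A} {p' : V' → A} {r' : I' → V'} {u' : I' → A}
    {f : I' → I} {g : I' → L} {κ : I → I'}
    (hf : IsRefinement M p r u p' r' u' f g κ)
    {U : I → B} {P P' : B} (hU : IsOrthogonalFamily U fun _ => P)
    {G : L → B} (hG : IsOrthogonalFamily G fun _ => P') (hP' : P' * P' = P')
    (hPG : ∀ l, P * G l = G l) {U' : I' → B} (hU' : U' = fun x => U (f x) * G (g x)) {y : B}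
    {a : A} (ha : a ∈ M)
    (hy : ∀ i j, r i = r j → star (U i) * y * U j = coeff p r u i j a • P)
    (hy' : ∀ i j, ∃ c : ℂ, star (U i) * y * U j = c • P) :
    (∑ x, U' x * star (U' x)) * y * (∑ x, U' x * star (U' x)) = frameMap p' r' u' U' a := by
  have hfam : IsOrthogonalFamily U' fun _ => P' := by
    rw [hU']
    exact hU.comp hG f g hf.injective fun x => hPG _
  refine IsFrame.frameMap_eq hfam hP' fun x z => ?_
  have h1 : star (U' x) * y * U' z = star (G (g x)) * (star (U (f x)) * y * U (f z)) * G (g z) := by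
    simp only [hU', star_mul, mul_assoc]
  rw [h1]
  by_cases hxz : g x = g z
  · rw [hy _ _ (hf.r_eq x z hxz), mul_smul_comm, smul_mul_assoc, mul_assoc, hPG, ← hxz, hG.initial,
      hf.coeff_eq a ha x z hxz]
  · obtain ⟨c, hc⟩ := hy' (f x) (f z)
    rw [hc, mul_smul_comm, smul_mul_assoc, mul_assoc, hPG, hG.orthogonal _ _ hxz,
      hf.coeff_eq_zero a ha x z hxz, smul_zero, zero_smul]

end Refinement

/-! ### Embedding matrix units into an AF-algebra with doubling -/

section Stages

variable {A B : Type*} [CStarAlgebra A] [NonUnitalCStarAlgebra B]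

/-- Below every minimal projection `e` of an algebra of the sequence `S` there are two equivalent
orthogonal minimal projections of a later one. They are encoded by partial isometries `g l` with
ranges below `e` and with a minimal projection `P` as common initial projection. -/
def HasDoubling (S : ℕ → NonUnitalStarSubalgebra ℂ B) : Prop :=
  ∀ n e, IsMinimalProjection (S n) e → ∃ m, n ≤ m ∧ ∃ (P : B) (g : Fin 2 → B),
    IsMinimalProjection (S m) P ∧ (∀ l, g l ∈ S m) ∧ IsOrthogonalFamily g (fun _ => P) ∧
      ∀ l, e * g l = g l

theorem HasDoubling.exists_pow {S : ℕ → NonUnitalStarSubalgebra ℂ B} (hS : HasDoubling S)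
    (hmono : Monotone S) {n : ℕ} {e : B} (he : IsMinimalProjection (S n) e) (k : ℕ) :
    ∃ m, n ≤ m ∧ ∃ (P : B) (g : Fin (2 ^ k) → B),
    IsMinimalProjection (S m) P ∧ (∀ l, g l ∈ S m) ∧ IsOrthogonalFamily g (fun _ => P) ∧
      ∀ l, e * g l = g l := by
  induction k with
  | zero =>
    refine ⟨n, le_rfl, e, fun _ => e, he, fun _ => he.mem, ⟨fun _ => ?_, fun i j hij => ?_⟩,
      fun _ => he.mul_self⟩
    · rw [he.star_eq, he.mul_self]
    · exact absurd (Subsingleton.elim (α := Fin 1) i j) hij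
  | succ k ih =>
    obtain ⟨m, hm, P, g, hP, hg, hfam, heg⟩ := ih
    obtain ⟨m', hm', P', g', hP', hg', hfam', heg'⟩ := hS m P hP
    let σ : Fin (2 ^ (k + 1)) ≃ Fin (2 ^ k) × Fin 2 :=
      (finCongr (pow_succ 2 k)).trans finProdFinEquiv.symm
    refine ⟨m', hm.trans hm', P', fun l => g (σ l).1 * g' (σ l).2, hP',
      fun l => mul_mem (hmono hm' (hg _)) (hg' _),
      hfam.comp hfam' (fun l => (σ l).1) (fun l => (σ l).2) σ.injective fun l => heg' _, fun l => ?_⟩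
    rw [← mul_assoc, heg]

/-- Iterated doubling gives arbitrarily many equivalent orthogonal minimal projections below `e`, at
arbitrarily late levels of the sequence. -/
theorem HasDoubling.exists_family {S : ℕ → NonUnitalStarSubalgebra ℂ B} (hS : HasDoubling S)
    (hmono : Monotone S) (hfin : ∀ n, FiniteDimensional ℂ (S n)) {n : ℕ} {e : B}
    (he : IsMinimalProjection (S n) e) (N : ℕ) (L : Type) [Finite L] :
    ∃ m, N ≤ m ∧ n ≤ m ∧ ∃ (P : B) (g : L → B),
    IsMinimalProjection (S m) P ∧ (∀ l, g l ∈ S m) ∧ IsOrthogonalFamily g (fun _ => P) ∧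
      ∀ l, e * g l = g l := by
  obtain ⟨k, ⟨σ⟩⟩ := Finite.exists_equiv_fin L
  obtain ⟨m, hm, P, g, hP, hg, hfam, heg⟩ := hS.exists_pow hmono he k
  have hk : k ≤ 2 ^ k := Nat.lt_two_pow_self.le
  obtain ⟨Q, hQ, hPQ⟩ := exists_isMinimalProjection_le (S (max m N)) hP.isStarProjection
    (hmono (le_max_left m N) hP.mem) hP.ne_zero
  let τ : L → Fin (2 ^ k) := fun l => Fin.castLE hk (σ l)
  have hτ : Function.Injective τ := (Fin.castLE_injective hk).comp σ.injective
  refine ⟨max m N, le_max_right _ _, hm.trans (le_max_left _ _), Q, fun l => g (τ l) * Q, hQ,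
    fun l => mul_mem (hmono (le_max_left _ _) (hg _)) hQ.mem, ⟨fun l => ?_, fun l l' hl => ?_⟩,
    fun l => by rw [← mul_assoc, heg]⟩
  · rw [star_mul, mul_assoc, ← mul_assoc (star (g _)), hfam.initial, hPQ, hQ.star_eq, hQ.mul_self]
  · rw [star_mul, mul_assoc, ← mul_assoc (star (g _)), hfam.orthogonal _ _ (hτ.ne hl), zero_mul,
      mul_zero]

/-- Matrix units of `M ⊆ A`, together with partial isometries `U i` in an algebra `S m` of the
sequence `S`, which have as common initial projection a minimal projection `P` of `S m`. -/
structure Stage (M : NonUnitalStarSubalgebra ℂ A) (S : ℕ → NonUnitalStarSubalgebra ℂ B) where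
  V : Type
  I : Type
  fintypeV : Fintype V
  fintypeI : Fintype I
  p : V → A
  r : I → V
  u : I → A
  frame : IsFrame M p r u
  m : ℕ
  P : B
  U : I → B
  minimal : IsMinimalProjection (S m) P
  mem : ∀ i, U i ∈ S m
  family : IsOrthogonalFamily U fun _ => P

namespace Stage

variable {M M' : NonUnitalStarSubalgebra ℂ A} {S : ℕ → NonUnitalStarSubalgebra ℂ B}

attribute [instance] Stage.fintypeV Stage.fintypeI

/-- The support projection of the realisation of `M` in `B`. -/
noncomputable def q (s : Stage M S) : B := ∑ i, s.U i * star (s.U i)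

/-- The realisation of `M` in `B`. -/
noncomputable def J (s : Stage M S) : A →ₗ[ℂ] B := frameMap s.p s.r s.u s.U

theorem isStarProjection_q (s : Stage M S) : IsStarProjection s.q :=
  s.family.isStarProjection_sum fun _ => s.minimal.mul_self

theorem q_mul_J_mul_q (s : Stage M S) (a : A) : s.q * s.J a * s.q = s.J a :=
  IsFrame.frameMap_eq s.family s.minimal.mul_self
    (IsFrame.frameMap_compress s.family s.minimal.mul_self a)

theorem J_mul (s : Stage M S) {a b : A} (ha : a ∈ M) (hb : b ∈ M) :
    s.J (a * b) = s.J a * s.J b :=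
  s.frame.frameMap_mul s.family s.minimal.mul_self ha hb

theorem J_star (s : Stage M S) {a : A} (ha : a ∈ M) : s.J (star a) = star (s.J a) :=
  s.frame.frameMap_star ha

theorem norm_J [FiniteDimensional ℂ M] (s : Stage M S) {a : A} (ha : a ∈ M) : ‖s.J a‖ = ‖a‖ :=
  s.frame.norm_frameMap s.family s.minimal.mul_self s.minimal.ne_zero ha

/-- The relations between two consecutive stages which are used to glue the realisations. The
support decreases, compression to the new support turns the old realisation into the new one and
maps the algebra `S s.m` into the realisation of `M`, and `M` is the range of a contractive
projection of `M'`. -/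
structure Link (s : Stage M S) (s' : Stage M' S) : Prop where
  lt : s.m < s'.m
  q_mul_q : s'.q * s.q = s'.q
  compress_J : ∀ a ∈ M, s'.q * s.J a * s'.q = s'.J a
  compress_mem : ∀ x ∈ S s.m, ∃ a ∈ M, s'.q * x * s'.q = s'.J a
  exists_projection : ∃ E : A →ₗ[ℂ] A, (∀ x ∈ M', E x ∈ M ∧ ‖E x‖ ≤ ‖x‖) ∧ ∀ x ∈ M, E x = x

/-- Every stage for `M` is followed by one for `M'`: the partial isometries `s.U i` are refined by
orthogonal partial isometries `G l` below their common initial projection, one for each edge `l` of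
the Bratteli diagram of `M ≤ M'`. Orthogonality of the `G l` is what kills the off-diagonal blocks, so
that the compression of `S s.m` lands in the realisation of `M`. -/
theorem exists_link (hS : HasDoubling S) (hmono : Monotone S)
    (hfin : ∀ n, FiniteDimensional ℂ (S n)) [FiniteDimensional ℂ M] [FiniteDimensional ℂ M']
    (hM : M ≤ M') (s : Stage M S) : ∃ s' : Stage M' S, Link s s' := by
  obtain ⟨V', I', L, _, _, _, p', r', u', f, g, κ, hframe, hf⟩ := s.frame.exists_refinement hM
  obtain ⟨m', hm', hm, P', G, hP', hG, hGfam, hPG⟩ :=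
    hS.exists_family hmono hfin s.minimal (s.m + 1) L
  obtain ⟨m'', -, -, P'', G', hP'', -, hG'fam, hPG'⟩ := hS.exists_family hmono hfin hP' 0 s.V
  have hfam : IsOrthogonalFamily (fun x => s.U (f x) * G (g x)) fun _ => P' :=
    s.family.comp hGfam f g hf.injective fun x => hPG _
  let s' : Stage M' S :=
    { V := V', I := I', fintypeV := inferInstance, fintypeI := inferInstance
      p := p', r := r', u := u', frame := hframe, m := m', P := P'
      U := fun x => s.U (f x) * G (g x)
      minimal := hP'
      mem := fun x => mul_mem (hmono hm (s.mem _)) (hG _)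
      family := hfam }
  have hcomp : ∀ (y : B) (a : A), a ∈ M →
      (∀ i j, s.r i = s.r j → star (s.U i) * y * s.U j = coeff s.p s.r s.u i j a • s.P) →
      (∀ i j, ∃ c : ℂ, star (s.U i) * y * s.U j = c • s.P) → s'.q * y * s'.q = s'.J a :=
    fun y a ha hy hy' => hf.compress_eq_frameMap s.family hGfam hP'.mul_self hPG rfl ha hy hy'
  refine ⟨s', hm', ?_, fun a ha => ?_, fun x hx => ?_, ?_⟩
  · have : s.q * s'.q = s'.q := by
      change s.q * (∑ x, s.U (f x) * G (g x) * star (s.U (f x) * G (g x))) = _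
      rw [Finset.mul_sum]
      refine Finset.sum_congr rfl fun x _ => ?_
      rw [← mul_assoc, ← mul_assoc, q, s.family.sum_mul fun _ => s.minimal.mul_self]
    have h2 := congrArg star this
    rwa [star_mul, s.isStarProjection_q.isSelfAdjoint.star_eq,
      s'.isStarProjection_q.isSelfAdjoint.star_eq] at h2
  · have h1 := IsFrame.frameMap_compress (p := s.p) (r := s.r) (u := s.u) s.family
      s.minimal.mul_self a
    exact hcomp _ a ha (fun i j _ => h1 i j) fun i j => ⟨_, h1 i j⟩
  · have hx' : ∀ i j, ∃ c : ℂ, star (s.U i) * x * s.U j = c • s.P := fun i j => by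
      obtain ⟨c, hc⟩ := s.minimal.compress (star (s.U i) * x * s.U j)
        (mul_mem (mul_mem (star_mem (s.mem i)) hx) (s.mem j))
      refine ⟨c, ?_⟩
      rw [← hc, ← mul_assoc, ← mul_assoc, s.family.star_right fun _ => s.minimal.mul_self,
        mul_assoc _ (s.U j), s.family.mul_right fun _ => s.minimal.mul_self]
    choose c hc using hx'
    refine ⟨_, s.frame.sum_mem c, hcomp _ _ (s.frame.sum_mem c) (fun i j hij => ?_)
      fun i j => ⟨_, hc i j⟩⟩
    rw [s.frame.coeff_sum c hij, hc]
  · exact s.frame.exists_contractive_projection hframe hf hfam hP'.mul_self hP'.ne_zero hG'fam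
      hP''.mul_self hP''.ne_zero hPG'

/-- The stage which realises the scalars by a minimal projection of the sequence `S`. -/
noncomputable def scalars [Nontrivial A] (hM : ∀ x, x ∈ M ↔ ∃ c : ℂ, x = c • (1 : A)) {m : ℕ}
    {P : B} (hP : IsMinimalProjection (S m) P) : Stage M S where
  V := Unit
  I := Unit
  fintypeV := inferInstance
  fintypeI := inferInstance
  p := fun _ => 1
  r := fun _ => ()
  u := fun _ => 1
  frame :=
    { minimal := fun _ => ⟨(hM 1).2 ⟨1, by simp⟩, IsStarProjection.one A, one_ne_zero,
        fun x hx => by simpa using (hM x).1 hx⟩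
      compress_eq_zero := fun v w h => absurd (Subsingleton.elim v w) h
      mem := fun _ => (hM 1).2 ⟨1, by simp⟩
      family := ⟨fun _ => by simp, fun i j h => absurd (Subsingleton.elim i j) h⟩
      sum := by simp }
  m := m
  P := P
  U := fun _ => P
  minimal := hP
  mem := fun _ => hP.mem
  family := ⟨fun _ => by rw [hP.star_eq, hP.mul_self],
    fun i j h => absurd (Subsingleton.elim i j) h⟩

/-- A sequence of stages for an increasing sequence of algebras starting with the scalars. -/
theorem exists_sequence [Nontrivial A] {R : ℕ → NonUnitalStarSubalgebra ℂ A} (hR : Monotone R)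
    (hRfin : ∀ n, FiniteDimensional ℂ (R n)) (hR0 : ∀ x, x ∈ R 0 ↔ ∃ c : ℂ, x = c • (1 : A))
    (hS : HasDoubling S) (hmono : Monotone S) (hfin : ∀ n, FiniteDimensional ℂ (S n))
    {m : ℕ} {P : B} (hP : IsMinimalProjection (S m) P) :
    ∃ s : ∀ n, Stage (R n) S, ∀ n, Link (s n) (s (n + 1)) := by
  choose next hnext using fun (n : ℕ) (s : Stage (R n) S) =>
    exists_link hS hmono hfin (hR (Nat.le_succ n)) s
  exact ⟨fun n => Nat.rec (scalars hR0 hP) next n, fun n => hnext n _⟩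

end Stage

end Stages

/-! ### Complemented subspaces -/

section Complemented

/-- The Banach space `X` is isomorphic to a complemented subspace of `Y`. -/
def IsComplementedIn (X Y : Type*) [NormedAddCommGroup X] [NormedSpace ℂ X]
    [NormedAddCommGroup Y] [NormedSpace ℂ Y] : Prop :=
  ∃ (J : X →L[ℂ] Y) (T : Y →L[ℂ] X), ∀ x, T (J x) = x

theorem IsComplementedIn.trans {X Y Z : Type*} [NormedAddCommGroup X] [NormedSpace ℂ X]
    [NormedAddCommGroup Y] [NormedSpace ℂ Y] [NormedAddCommGroup Z] [NormedSpace ℂ Z]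
    (h : IsComplementedIn X Y) (h' : IsComplementedIn Y Z) : IsComplementedIn X Z := by
  obtain ⟨J, T, hJT⟩ := h
  obtain ⟨J', T', hJT'⟩ := h'
  exact ⟨J'.comp J, T.comp T', fun x => by simp [hJT, hJT']⟩

/-- A bounded linear relation with dense domain is contained in the graph of a bounded operator. -/
theorem exists_clm_of_relation {X Y : Type*} [NormedAddCommGroup X] [NormedSpace ℂ X]
    [NormedAddCommGroup Y] [NormedSpace ℂ Y] [CompleteSpace Y] (G : Submodule ℂ (X × Y))
    (hdense : Dense (Prod.fst '' (G : Set (X × Y)))) (hG : ∀ z ∈ G, ‖z.2‖ ≤ ‖z.1‖) :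
    ∃ T : X →L[ℂ] Y, ∀ z ∈ G, T z.1 = z.2 := by
  let e : G →ₗ[ℂ] X := LinearMap.fst ℂ X Y ∘ₗ G.subtype
  let f : G →ₗ[ℂ] Y := LinearMap.snd ℂ X Y ∘ₗ G.subtype
  have he : DenseRange e := by
    refine hdense.mono ?_
    rintro _ ⟨z, hz, rfl⟩
    exact ⟨⟨z, hz⟩, rfl⟩
  refine ⟨f.extendOfNorm e, fun z hz => ?_⟩
  exact LinearMap.extendOfNorm_eq (f := f) (e := e) he
    ⟨1, fun x => by rw [one_mul]; exact hG x x.2⟩ ⟨z, hz⟩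

theorem norm_add_eq_max_of_orthogonal {A : Type*} [NonUnitalCStarAlgebra A] {x y : A}
    (h1 : star x * y = 0) (h2 : x * star y = 0) : ‖x + y‖ = max ‖x‖ ‖y‖ := by
  have h1' : star y * x = 0 := by simpa using congrArg star h1
  have key : star (x + y) * (x + y) = star x * x + star y * y := by
    rw [star_add, add_mul, mul_add, mul_add, h1, h1', add_zero, zero_add]
  have hmul : star x * x * (star y * y) = 0 := by
    rw [mul_assoc, ← mul_assoc x, h2, zero_mul, mul_zero]
  have hn : ‖star x * x + star y * y‖ = max ‖star x * x‖ ‖star y * y‖ :=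
    (IsSelfAdjoint.star_mul_self x).norm_add_eq_max (IsSelfAdjoint.star_mul_self y) hmul
  rw [← key, CStarRing.norm_star_mul_self, CStarRing.norm_star_mul_self,
    CStarRing.norm_star_mul_self] at hn
  rw [← abs_of_nonneg (norm_nonneg (x + y)), ← abs_of_nonneg (le_max_of_le_left (norm_nonneg x)),
    ← sq_eq_sq_iff_abs_eq_abs, sq, hn]
  rcases le_total ‖x‖ ‖y‖ with h | h
  · rw [max_eq_right h, max_eq_right (mul_self_le_mul_self (norm_nonneg _) h), sq]
  · rw [max_eq_left h, max_eq_left (mul_self_le_mul_self (norm_nonneg _) h), sq]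

end Complemented

/-! ### Gluing the realisations -/

section Gluing

variable {A B : Type*} [CStarAlgebra A] [NonUnitalCStarAlgebra B]

namespace Stage

variable {S : ℕ → NonUnitalStarSubalgebra ℂ B}

theorem q_mul_J {M : NonUnitalStarSubalgebra ℂ A} (s : Stage M S) (a : A) :
    s.q * s.J a = s.J a := by
  rw [← s.q_mul_J_mul_q a, ← mul_assoc, ← mul_assoc, s.isStarProjection_q.isIdempotentElem.eq]

theorem J_mul_q {M : NonUnitalStarSubalgebra ℂ A} (s : Stage M S) (a : A) :
    s.J a * s.q = s.J a := by
  rw [← s.q_mul_J_mul_q a, mul_assoc, s.isStarProjection_q.isIdempotentElem.eq]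

namespace Link

variable {M M' : NonUnitalStarSubalgebra ℂ A} {s : Stage M S} {s' : Stage M' S}

theorem q_mul_q' (h : Link s s') : s.q * s'.q = s'.q := by
  have := congrArg star h.q_mul_q
  rwa [star_mul, s.isStarProjection_q.isSelfAdjoint.star_eq,
    s'.isStarProjection_q.isSelfAdjoint.star_eq] at this

/-- The support of the later stage commutes with the earlier realisation: the compression to it is
multiplicative. -/
theorem J_mul_q (h : Link s s') (hM : M ≤ M') {a : A} (ha : a ∈ M) :
    s.J a * s'.q = s'.J a := by
  refine sub_eq_zero.1 (star_mul_self_eq_zero' ?_)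
  have hq : star s'.q = s'.q := s'.isStarProjection_q.isSelfAdjoint.star_eq
  have ha' : star a ∈ M := star_mem ha
  have e1 : s'.q * s.J (star a) * (s.J a * s'.q) = s'.J (star a * a) := by
    rw [← h.compress_J _ (mul_mem ha' ha), s.J_mul ha' ha]; simp only [mul_assoc]
  have e2 : s'.q * s.J (star a) * s'.J a = s'.J (star a * a) := by
    rw [s'.J_mul (hM ha') (hM ha), ← h.compress_J _ ha', mul_assoc _ s'.q, s'.q_mul_J]
  have e3 : s'.J (star a) * (s.J a * s'.q) = s'.J (star a * a) := by
    rw [s'.J_mul (hM ha') (hM ha), ← h.compress_J _ ha, ← s'.J_mul_q (star a)]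
    simp only [mul_assoc]
    rw [← mul_assoc s'.q s'.q, s'.isStarProjection_q.isIdempotentElem.eq]
  rw [star_sub, star_mul, hq, ← s.J_star ha, ← s'.J_star (hM ha), sub_mul, mul_sub, mul_sub, e1, e2,
    e3, ← s'.J_mul (hM ha') (hM ha), sub_self]

theorem q_mul_J (h : Link s s') (hM : M ≤ M') {a : A} (ha : a ∈ M) :
    s'.q * s.J a = s'.J a := by
  have := congrArg star (h.J_mul_q hM (star_mem ha))
  rwa [star_mul, ← s.J_star (star_mem ha), ← s'.J_star (hM (star_mem ha)), star_star,
    s'.isStarProjection_q.isSelfAdjoint.star_eq] at this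

end Link

variable {R : ℕ → NonUnitalStarSubalgebra ℂ A}

theorem q_mul_q_of_le {s : ∀ n, Stage (R n) S} (hs : ∀ n, Link (s n) (s (n + 1))) {n k : ℕ}
    (hnk : n ≤ k) : (s k).q * (s n).q = (s k).q := by
  induction k, hnk using Nat.le_induction with
  | base => exact (s n).isStarProjection_q.isIdempotentElem
  | succ k _ ih => rw [← (hs k).q_mul_q, mul_assoc, ih]

theorem q_mul_q_of_le' {s : ∀ n, Stage (R n) S} (hs : ∀ n, Link (s n) (s (n + 1))) {n k : ℕ}
    (hnk : n ≤ k) : (s n).q * (s k).q = (s k).q := by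
  have := congrArg star (q_mul_q_of_le hs hnk)
  rwa [star_mul, (s n).isStarProjection_q.isSelfAdjoint.star_eq,
    (s k).isStarProjection_q.isSelfAdjoint.star_eq] at this

theorem compress_of_le {s : ∀ n, Stage (R n) S} (hs : ∀ n, Link (s n) (s (n + 1)))
    {n k : ℕ} (hnk : n ≤ k) (y : B) :
    (s k).q * y * (s k).q = (s k).q * ((s n).q * y * (s n).q) * (s k).q := by
  have : (s k).q * ((s n).q * y * (s n).q) * (s k).q =
      (s k).q * (s n).q * y * ((s n).q * (s k).q) := by simp only [mul_assoc]
  rw [this, q_mul_q_of_le hs hnk, q_mul_q_of_le' hs hnk]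

theorem compress_J_of_le (hR : Monotone R) {s : ∀ n, Stage (R n) S}
    (hs : ∀ n, Link (s n) (s (n + 1))) {n k : ℕ} (hnk : n ≤ k) {a : A} (ha : a ∈ R n) :
    (s k).q * (s n).J a * (s k).q = (s k).J a := by
  induction k, hnk using Nat.le_induction with
  | base => exact (s n).q_mul_J_mul_q a
  | succ k hk ih =>
    rw [compress_of_le hs (Nat.le_succ k), ih, (hs k).compress_J a (hR hk ha)]

/-- The lifting `A → B` on the `n`-th algebra. On the complement of the support of the stage
`n + 1`, it is determined by the conditional expectation of the argument onto the `n`-th algebra. -/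
noncomputable def lift (s : ∀ n, Stage (R n) S) (E : ℕ → A →ₗ[ℂ] A) : ℕ → A →ₗ[ℂ] B
  | 0 => (s 0).J
  | n + 1 => lift s E n ∘ₗ E n + (s (n + 1)).J ∘ₗ (LinearMap.id - E n)

theorem lift_succ (s : ∀ n, Stage (R n) S) (E : ℕ → A →ₗ[ℂ] A) (n : ℕ) (a : A) :
    lift s E (n + 1) a = lift s E n (E n a) - (s (n + 1)).J (E n a) + (s (n + 1)).J a := by
  simp [lift]; abel

/-- The support of the stage `n` reduces the lifting, which restricts to the realisation there. -/
theorem q_mul_lift (hR : Monotone R) {s : ∀ n, Stage (R n) S}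
    (hs : ∀ n, Link (s n) (s (n + 1))) {E : ℕ → A →ₗ[ℂ] A}
    (hE : ∀ n, ∀ x ∈ R (n + 1), E n x ∈ R n ∧ ‖E n x‖ ≤ ‖x‖) (n : ℕ) {a : A} (ha : a ∈ R n) :
    (s n).q * lift s E n a = (s n).J a ∧ lift s E n a * (s n).q = (s n).J a := by
  induction n generalizing a with
  | zero => exact ⟨(s 0).q_mul_J a, (s 0).J_mul_q a⟩
  | succ n ih =>
    have hb := (hE n a ha).1
    obtain ⟨h1, h2⟩ := ih hb
    have hle := hR (Nat.le_succ n)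
    constructor
    · rw [lift_succ, mul_add, mul_sub, ← (hs n).q_mul_q, mul_assoc, h1, (hs n).q_mul_J hle hb,
        (hs n).q_mul_q, q_mul_J, q_mul_J, sub_self, zero_add]
    · rw [lift_succ, add_mul, sub_mul, ← (hs n).q_mul_q', ← mul_assoc, h2, (hs n).J_mul_q hle hb,
        (hs n).q_mul_q', J_mul_q, J_mul_q, sub_self, zero_add]

/-- The lifting is contractive: its value is an orthogonal sum of a compression of the previous
lifting of `E n a` and of the realisation of `a`. -/
theorem norm_lift_le (hR : Monotone R) [∀ n, FiniteDimensional ℂ (R n)] {s : ∀ n, Stage (R n) S}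
    (hs : ∀ n, Link (s n) (s (n + 1))) {E : ℕ → A →ₗ[ℂ] A}
    (hE : ∀ n, ∀ x ∈ R (n + 1), E n x ∈ R n ∧ ‖E n x‖ ≤ ‖x‖) (n : ℕ) {a : A} (ha : a ∈ R n) :
    ‖lift s E n a‖ ≤ ‖a‖ := by
  induction n generalizing a with
  | zero => exact ((s 0).norm_J ha).le
  | succ n ih =>
    obtain ⟨hb, hba⟩ := hE n a ha
    obtain ⟨h1, h2⟩ := q_mul_lift hR hs hE n hb
    have hle := hR (Nat.le_succ n)
    have hq : star (s (n + 1)).q = (s (n + 1)).q :=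
      (s (n + 1)).isStarProjection_q.isSelfAdjoint.star_eq
    set x := lift s E n (E n a)
    set u := x - (s (n + 1)).J (E n a) with hu
    have hqu : (s (n + 1)).q * u = 0 := by
      rw [hu, mul_sub, ← (hs n).q_mul_q, mul_assoc, h1, (hs n).q_mul_J hle hb, (hs n).q_mul_q,
        q_mul_J, sub_self]
    have huq : u * (s (n + 1)).q = 0 := by
      rw [hu, sub_mul, ← (hs n).q_mul_q', ← mul_assoc, h2, (hs n).J_mul_q hle hb, (hs n).q_mul_q',
        J_mul_q, sub_self]
    have horth : ∀ c, ‖u + (s (n + 1)).J c‖ = max ‖u‖ ‖(s (n + 1)).J c‖ := fun c => by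
      apply norm_add_eq_max_of_orthogonal
      · rw [← q_mul_J, ← mul_assoc, ← hq, ← star_mul, hqu, star_zero, zero_mul]
      · rw [← J_mul_q, star_mul, hq, ← mul_assoc, huq, zero_mul]
    have hux : ‖u‖ ≤ ‖x‖ := by
      have : x = u + (s (n + 1)).J (E n a) := by rw [hu, sub_add_cancel]
      rw [this, horth]
      exact le_max_left _ _
    rw [lift_succ, horth, (s (n + 1)).norm_J ha]
    exact max_le (hux.trans ((ih hb).trans hba)) le_rfl

theorem lift_of_le (hR : Monotone R) (s : ∀ n, Stage (R n) S) {E : ℕ → A →ₗ[ℂ] A}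
    (hE : ∀ n, ∀ x ∈ R n, E n x = x) {n k : ℕ} (hnk : n ≤ k) {a : A} (ha : a ∈ R n) :
    lift s E k a = lift s E n a := by
  induction k, hnk using Nat.le_induction with
  | base => rfl
  | succ k hk ih => rw [lift_succ, hE k a (hR hk ha), ih]; abel

/-- A linked sequence of stages exhibits `A` as a complemented subspace of `B`. The compressions to
the supports map more and more of `B` to realisations of elements of `A`, which defines a contraction
`B → A`; the liftings, which stabilise on each `R n`, define a right inverse. -/
theorem isComplementedIn (hR : Monotone R) [∀ n, FiniteDimensional ℂ (R n)]
    (hRd : Dense (⋃ n, (R n : Set A))) (hS : Monotone S) (hSd : Dense (⋃ n, (S n : Set B)))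
    {s : ∀ n, Stage (R n) S} (hs : ∀ n, Link (s n) (s (n + 1))) : IsComplementedIn A B := by
  choose E hE hE' using fun n => (hs n).exists_projection
  have hm : StrictMono fun n => (s n).m := strictMono_nat_of_lt_succ fun n => (hs n).lt
  -- The quotient map: `x ↦ a` if the compressions of `x` eventually realise `a`.
  let G : Submodule ℂ (B × A) :=
    { carrier := {z | ∃ n, ∀ k, n ≤ k → z.2 ∈ R k ∧ (s k).q * z.1 * (s k).q = (s k).J z.2}
      add_mem' := by
        rintro z w ⟨n, hn⟩ ⟨m, hm⟩
        refine ⟨max n m, fun k hk => ?_⟩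
        obtain ⟨h1, h2⟩ := hn k ((le_max_left _ _).trans hk)
        obtain ⟨h3, h4⟩ := hm k ((le_max_right _ _).trans hk)
        exact ⟨add_mem h1 h3, by simp only [Prod.fst_add, Prod.snd_add, mul_add, add_mul, h2, h4,
          map_add]⟩
      zero_mem' := ⟨0, fun k _ => ⟨zero_mem _, by simp⟩⟩
      smul_mem' := by
        rintro c z ⟨n, hn⟩
        exact ⟨n, fun k hk => ⟨SMulMemClass.smul_mem c (hn k hk).1, by
          simp only [Prod.smul_fst, Prod.smul_snd, mul_smul_comm, smul_mul_assoc, (hn k hk).2,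
            map_smul]⟩⟩ }
  have hq : ∀ n, ‖(s n).q‖ ≤ 1 := fun n => (s n).isStarProjection_q.norm_le
  obtain ⟨T, hT⟩ := exists_clm_of_relation G (by
    refine hSd.mono fun x hx => ?_
    obtain ⟨n, hn⟩ := Set.mem_iUnion.1 hx
    have hn' : x ∈ S (s n).m := hS (hm.id_le n) hn
    obtain ⟨a, ha, hxa⟩ := (hs n).compress_mem x hn'
    have hle := hR (Nat.le_succ n)
    refine ⟨(x, a), ⟨n + 1, fun k hk => ⟨hR hk (hle ha), ?_⟩⟩, rfl⟩
    rw [compress_of_le hs hk, hxa, compress_J_of_le hR hs hk (hle ha)]) (by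
    rintro ⟨x, a⟩ ⟨n, hn⟩
    obtain ⟨h1, h2⟩ := hn n le_rfl
    change ‖a‖ ≤ ‖x‖
    rw [← (s n).norm_J h1, ← h2]
    calc _ ≤ ‖(s n).q‖ * ‖x‖ * ‖(s n).q‖ :=
          (norm_mul_le _ _).trans (mul_le_mul_of_nonneg_right (norm_mul_le _ _) (norm_nonneg _))
      _ ≤ 1 * ‖x‖ * 1 := by gcongr <;> exact hq n
      _ = _ := by ring)
  -- The lifting.
  let G' : Submodule ℂ (A × B) :=
    { carrier := {z | ∃ n, ∀ k, n ≤ k → z.1 ∈ R k ∧ lift s E k z.1 = z.2}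
      add_mem' := by
        rintro z w ⟨n, hn⟩ ⟨m, hm⟩
        refine ⟨max n m, fun k hk => ?_⟩
        obtain ⟨h1, h2⟩ := hn k ((le_max_left _ _).trans hk)
        obtain ⟨h3, h4⟩ := hm k ((le_max_right _ _).trans hk)
        exact ⟨add_mem h1 h3, by simp only [Prod.fst_add, Prod.snd_add, map_add, h2, h4]⟩
      zero_mem' := ⟨0, fun k _ => ⟨zero_mem _, by simp⟩⟩
      smul_mem' := by
        rintro c z ⟨n, hn⟩
        exact ⟨n, fun k hk => ⟨SMulMemClass.smul_mem c (hn k hk).1, by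
          simp only [Prod.smul_fst, Prod.smul_snd, map_smul, (hn k hk).2]⟩⟩ }
  have hG' : ∀ n, ∀ a ∈ R n, (a, lift s E n a) ∈ G' := fun n a ha =>
    ⟨n, fun k hk => ⟨hR hk ha, lift_of_le hR s hE' hk ha⟩⟩
  obtain ⟨J, hJ⟩ := exists_clm_of_relation G' (by
    refine hRd.mono fun a ha => ?_
    obtain ⟨n, hn⟩ := Set.mem_iUnion.1 ha
    exact ⟨_, hG' n a hn, rfl⟩) (by
    rintro ⟨a, b⟩ ⟨n, hn⟩
    obtain ⟨h1, h2⟩ := hn n le_rfl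
    change ‖b‖ ≤ ‖a‖
    have h2' : lift s E n a = b := h2
    rw [← h2']
    exact norm_lift_le hR hs hE n h1)
  refine ⟨J, T, fun a => ?_⟩
  refine congrFun (Continuous.ext_on hRd (T.continuous.comp J.continuous) continuous_id
    fun a ha => ?_) a
  obtain ⟨n, hn⟩ := Set.mem_iUnion.1 ha
  change T (J a) = a
  rw [hJ _ (hG' n a hn)]
  refine hT (lift s E n a, a) ⟨n, fun k hk => ⟨hR hk hn, ?_⟩⟩
  change (s k).q * lift s E n a * (s k).q = (s k).J a
  rw [← lift_of_le hR s hE' hk hn, (q_mul_lift hR hs hE k (hR hk hn)).1, J_mul_q]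

end Stage

end Gluing

/-! ### AF-algebras are complemented in AF-algebras with doubling -/

section Unitize

variable {A : Type*} [NonUnitalCStarAlgebra A]

/-- The subalgebra `ℂ + N` of the unitization. -/
def unitizeSubalgebra (N : NonUnitalStarSubalgebra ℂ A) :
    NonUnitalStarSubalgebra ℂ (Unitization ℂ A) where
  carrier := {x | x.snd ∈ N}
  add_mem' := fun {x y} hx hy => by
    change (x + y).snd ∈ N
    rw [Unitization.snd_add]; exact add_mem hx hy
  zero_mem' := zero_mem N
  mul_mem' := fun {x y} hx hy => by
    change (x * y).snd ∈ N
    rw [Unitization.snd_mul]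
    exact add_mem (add_mem (SMulMemClass.smul_mem _ hy) (SMulMemClass.smul_mem _ hx))
      (mul_mem hx hy)
  smul_mem' := fun c x hx => by
    change (c • x).snd ∈ N
    rw [Unitization.snd_smul]; exact SMulMemClass.smul_mem c hx
  star_mem' := fun {x} hx => by
    change (star x).snd ∈ N
    rw [Unitization.snd_star]; exact star_mem hx

instance (N : NonUnitalStarSubalgebra ℂ A) [FiniteDimensional ℂ N] :
    FiniteDimensional ℂ (unitizeSubalgebra N) := by
  let φ : unitizeSubalgebra N →ₗ[ℂ] ℂ × N :=
    { toFun := fun x => (x.1.fst, ⟨x.1.snd, x.2⟩)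
      map_add' := fun x y => rfl
      map_smul' := fun c x => rfl }
  refine FiniteDimensional.of_injective φ fun x y hxy => Subtype.ext (Unitization.ext ?_ ?_)
  · exact congrArg (fun z : ℂ × N => z.1) hxy
  · exact congrArg (fun z : ℂ × N => (z.2 : A)) hxy

theorem isComplementedIn_unitization : IsComplementedIn A (Unitization ℂ A) := by
  refine ⟨LinearMap.mkContinuous (Unitization.inrHom ℂ ℂ A) 1 fun x => ?_,
    ⟨Unitization.sndHom ℂ ℂ A, ?_⟩, fun x => ?_⟩
  · simp [Unitization.norm_inr]
  · exact Unitization.continuous_snd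
  · exact Unitization.snd_inr ℂ x

/-- Every AF-algebra is complemented in every nonzero AF-algebra with doubling. The unitization serves
to start the sequence of subalgebras with the scalars. -/
theorem IsAFAlgebra.isComplementedIn (hA : IsAFAlgebra A) {B : Type*} [NonUnitalCStarAlgebra B]
    {S : ℕ → NonUnitalStarSubalgebra ℂ B} (hS : HasDoubling S) (hmono : Monotone S)
    (hfin : ∀ n, FiniteDimensional ℂ (S n)) (hSd : Dense (⋃ n, (S n : Set B)))
    [Nontrivial B] : IsComplementedIn A B := by
  obtain ⟨m, P, hP⟩ : ∃ m P, IsMinimalProjection (S m) P := by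
    obtain ⟨x, hx⟩ := exists_ne (0 : B)
    obtain ⟨y, hy0, hy⟩ := hSd.inter_open_nonempty {0}ᶜ isOpen_compl_singleton ⟨x, hx⟩
    obtain ⟨m, hm⟩ := Set.mem_iUnion.1 hy
    exact ⟨m, exists_isMinimalProjection hm hy0⟩
  obtain ⟨N, hN, hNfin, hNd⟩ := hA
  -- The sequence of subalgebras is made to start with `0`.
  let N' : ℕ → NonUnitalStarSubalgebra ℂ A := fun n =>
    Nat.casesOn (motive := fun _ => NonUnitalStarSubalgebra ℂ A) n ⊥ N
  have hN'fin : ∀ n : ℕ, FiniteDimensional ℂ ↥(N' n) := by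
    rintro (_ | n)
    · have : Subsingleton (⊥ : NonUnitalStarSubalgebra ℂ A) := ⟨fun x y => Subtype.ext (by
        rw [NonUnitalStarAlgebra.mem_bot.1 x.2, NonUnitalStarAlgebra.mem_bot.1 y.2])⟩
      change FiniteDimensional ℂ (⊥ : NonUnitalStarSubalgebra ℂ A)
      infer_instance
    · exact hNfin n
  have hN' : Monotone N' := monotone_nat_of_le_succ (by
    rintro (_ | n)
    · exact bot_le
    · exact hN (Nat.le_succ n))
  let R : ℕ → NonUnitalStarSubalgebra ℂ (Unitization ℂ A) := fun n => unitizeSubalgebra (N' n)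
  have hR : Monotone R := fun m n hmn x hx => hN' hmn hx
  have hR0 : ∀ x, x ∈ R 0 ↔ ∃ c : ℂ, x = c • (1 : Unitization ℂ A) := fun x => by
    change x.snd ∈ (⊥ : NonUnitalStarSubalgebra ℂ A) ↔ _
    rw [NonUnitalStarAlgebra.mem_bot]
    constructor
    · intro hx
      exact ⟨x.fst, Unitization.ext (by simp) (by simp [hx])⟩
    · rintro ⟨c, rfl⟩
      simp
  have hRd : Dense (⋃ n, (R n : Set (Unitization ℂ A))) := by
    intro x
    let φ : A → Unitization ℂ A := fun a => Unitization.inl x.fst + (a : Unitization ℂ A)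
    have hφ : Continuous φ := continuous_const.add Unitization.continuous_inr
    have hx : x = φ x.snd := (Unitization.inl_fst_add_inr_snd_eq x).symm
    rw [hx]
    refine map_mem_closure hφ (hNd x.snd) fun a ha => ?_
    obtain ⟨n, hn⟩ := Set.mem_iUnion.1 ha
    refine Set.mem_iUnion.2 ⟨n + 1, ?_⟩
    change (φ a).snd ∈ N n
    simpa [φ] using hn
  have hRfin : ∀ n : ℕ, FiniteDimensional ℂ ↥(R n) := fun n => by
    have := hN'fin n
    change FiniteDimensional ℂ (unitizeSubalgebra (N' n))
    infer_instance
  obtain ⟨s, hs⟩ := Stage.exists_sequence hR hRfin hR0 hS hmono hfin hP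
  exact isComplementedIn_unitization.trans (Stage.isComplementedIn hR hRd hmono hSd hs)

end Unitize

/-! ### The dichotomy for simple AF-algebras -/

section Dichotomy

variable {A : Type*} [NonUnitalCStarAlgebra A]

/-- A corner of a finite-dimensional algebra is commutative, or it contains two equivalent
orthogonal minimal projections. -/
theorem corner_commutative_or_exists_pair (M : NonUnitalStarSubalgebra ℂ A)
    [FiniteDimensional ℂ M] {e : A} (he : IsStarProjection e) (heM : e ∈ M) :
    (∀ x ∈ M, ∀ y ∈ M, Commute (e * x * e) (e * y * e)) ∨
    ∃ (P : A) (g : Fin 2 → A), IsMinimalProjection M P ∧ (∀ l, g l ∈ M) ∧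
      IsOrthogonalFamily g (fun _ => P) ∧ ∀ l, e * g l = g l := by
  obtain ⟨k, p, hp⟩ := exists_isRepresentatives M
  obtain ⟨n, w, t, hw, hfam, hsum⟩ := hp.exists_decomposition he heM
  have hpp : ∀ l, p (t l) * p (t l) = p (t l) := fun l => (hp.isMinimalProjection _).mul_self
  by_cases ht : Function.Injective t
  · left
    have hwp := hfam.mul_right hpp
    have hpw := hfam.star_right hpp
    -- The compressions are linear combinations of the orthogonal projections `w l * star (w l)`.
    have key : ∀ x ∈ M, ∃ c : Fin n → ℂ, e * x * e = ∑ l, c l • (w l * star (w l)) := by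
      intro x hx
      have hmem : ∀ l k, star (w l) * x * w k ∈ M := fun l k =>
        mul_mem (mul_mem (star_mem (hw l)) hx) (hw k)
      have hred : ∀ l k, star (w l) * x * w k = p (t l) * (star (w l) * x * w k) * p (t k) := by
        intro l k
        rw [← mul_assoc, ← mul_assoc, hpw, mul_assoc _ (w k), hwp]
      choose c hc using fun l => (hp.isMinimalProjection (t l)).compress _ (hmem l l)
      refine ⟨c, ?_⟩
      conv_lhs => rw [← hsum, Finset.sum_mul, Finset.sum_mul]
      refine Finset.sum_congr rfl fun l _ => ?_
      rw [Finset.mul_sum, Finset.sum_eq_single l]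
      · have : w l * star (w l) * x * (w l * star (w l)) =
            w l * (star (w l) * x * w l) * star (w l) := by simp only [mul_assoc]
        rw [this, hred, hc, mul_smul_comm, smul_mul_assoc, hwp]
      · intro j _ hj
        have : w l * star (w l) * x * (w j * star (w j)) =
            w l * (star (w l) * x * w j) * star (w j) := by simp only [mul_assoc]
        rw [this, hred, hp.compress_eq_zero _ _ (ht.ne hj.symm) _ (hmem l j), mul_zero, zero_mul]
      · simp
    intro x hx y hy
    obtain ⟨c, hc⟩ := key x hx
    obtain ⟨d, hd⟩ := key y hy
    rw [hc, hd]
    refine Commute.sum_left _ _ _ fun l _ => Commute.sum_right _ _ _ fun j _ => ?_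
    refine Commute.smul_left (Commute.smul_right ?_ _) _
    by_cases hlj : l = j
    · rw [hlj]
    · have h0 : ∀ a b, a ≠ b → w a * star (w a) * (w b * star (w b)) = 0 := fun a b hab => by
        rw [mul_assoc, ← mul_assoc (star (w a)), hfam.orthogonal _ _ hab, zero_mul, mul_zero]
      change _ * _ = _ * _
      rw [h0 _ _ hlj, h0 _ _ (Ne.symm hlj)]
  · right
    simp only [Function.Injective, not_forall] at ht
    obtain ⟨l, j, hlj, hne⟩ := ht
    have hew : ∀ l, e * w l = w l := fun l => by rw [← hsum]; exact hfam.sum_mul hpp l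
    have hinj : Function.Injective ![l, j] := by
      intro a b
      fin_cases a <;> fin_cases b <;> simp [hne, Ne.symm hne]
    refine ⟨p (t l), fun a => w (![l, j] a), hp.isMinimalProjection _, fun a => hw _,
      ⟨fun a => ?_, fun a b hab => hfam.orthogonal _ _ (hinj.ne hab)⟩, fun a => hew _⟩
    rw [hfam.initial]
    fin_cases a
    · rfl
    · exact congrArg p hlj.symm

/-- If the corner cut out by a projection in a simple AF-algebra is commutative, then it consists of
scalars: orthogonal nonzero elements `h`, `z` of the corner would generate orthogonal ideals. -/
theorem IsSimpleCStarAlgebra.corner_scalar (hA : IsSimpleCStarAlgebra A)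
    {S : ℕ → NonUnitalStarSubalgebra ℂ A} (hmono : Monotone S)
    (hfin : ∀ n, FiniteDimensional ℂ (S n)) (hSd : Dense (⋃ n, (S n : Set A))) {n : ℕ} {e : A}
    (he : IsStarProjection e) (heM : e ∈ S n)
    (hcomm : ∀ m, n ≤ m → ∀ x ∈ S m, ∀ y ∈ S m, Commute (e * x * e) (e * y * e)) (x : A) :
    ∃ c : ℂ, e * x * e = c • e := by
  have key : ∀ m, n ≤ m → ∀ x ∈ S m, ∃ c : ℂ, e * x * e = c • e := by
    intro m hm x hx
    by_contra hns
    obtain ⟨h, hh, z, hz, -, hh0, hz0, hhz⟩ :=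
      exists_zero_divisors_corner (S m) he (hmono hm heM) hx hns
    have haz : ∀ a, h * a * z = 0 := by
      intro a
      have hcl : IsClosed {a : A | h * a * z = 0} :=
        isClosed_eq (by fun_prop) continuous_const
      refine hcl.closure_subset_iff.2 ?_ (hSd a)
      intro a ha
      obtain ⟨k, hk⟩ := Set.mem_iUnion.1 ha
      have hc := hcomm (max m k) (hm.trans (le_max_left _ _)) h (hmono (le_max_left _ _) hh.1) a
        (hmono (le_max_right _ _) hk)
      have e1 : e * h * e = h := by rw [hh.2.1, hh.2.2]
      rw [e1] at hc
      calc h * a * z = h * (e * a * e) * z := by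
            conv_lhs => rw [← hh.2.2, ← hz.2.1]
            simp only [mul_assoc]
        _ = e * a * e * (h * z) := by rw [hc.eq, mul_assoc]
        _ = 0 := by rw [hhz, mul_zero]
    let I : Submodule ℂ A :=
      { carrier := {x | ∀ a, x * a * z = 0}
        add_mem' := fun hx hy a => by rw [add_mul, add_mul, hx a, hy a, add_zero]
        zero_mem' := fun a => by simp
        smul_mem' := fun c x hx a => by rw [smul_mul_assoc, smul_mul_assoc, hx a, smul_zero] }
    have hIc : IsClosed (I : Set A) := by
      have : (I : Set A) = ⋂ a, {x | x * a * z = 0} := by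
        ext x; simp [I]
      rw [this]
      exact isClosed_iInter fun a => isClosed_eq (by fun_prop) continuous_const
    have hI : ∀ a : A, ∀ x ∈ I, a * x ∈ I ∧ x * a ∈ I := by
      intro a x hx
      refine ⟨fun b => ?_, fun b => ?_⟩
      · rw [mul_assoc, mul_assoc, ← mul_assoc x, hx b, mul_zero]
      · rw [mul_assoc x]; exact hx (a * b)
    rcases hA.2 I hIc hI with hbot | htop
    · have : h ∈ I := haz
      rw [hbot] at this
      exact hh0 ((Submodule.mem_bot ℂ).1 this)
    · have : star z ∈ I := htop ▸ Submodule.mem_top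
      have h1 := this e
      rw [mul_assoc, hz.2.1] at h1
      exact hz0 (star_mul_self_eq_zero' h1)
  have hcl : IsClosed {x : A | e * x * e ∈ Submodule.span ℂ {e}} :=
    (Submodule.closed_of_finiteDimensional (Submodule.span ℂ {e})).preimage (by fun_prop)
  have : e * x * e ∈ Submodule.span ℂ {e} := by
    refine hcl.closure_subset_iff.2 ?_ (hSd x)
    intro y hy
    obtain ⟨k, hk⟩ := Set.mem_iUnion.1 hy
    obtain ⟨c, hc⟩ := key (max n k) (le_max_left _ _) y (hmono (le_max_right _ _) hk)
    exact Submodule.mem_span_singleton.2 ⟨c, hc.symm⟩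
  obtain ⟨c, hc⟩ := Submodule.mem_span_singleton.1 this
  exact ⟨c, hc.symm⟩

/-- If a minimal projection `e` violates doubling, then all later corners at `e` are commutative, and
simplicity reduces `e A e` to the scalars. -/
theorem IsSimpleCStarAlgebra.hasDoubling_or (hA : IsSimpleCStarAlgebra A)
    {S : ℕ → NonUnitalStarSubalgebra ℂ A} (hmono : Monotone S)
    (hfin : ∀ n, FiniteDimensional ℂ (S n)) (hSd : Dense (⋃ n, (S n : Set A))) :
    HasDoubling S ∨ ∃ p : A, IsStarProjection p ∧ p ≠ 0 ∧ ∀ x : A, ∃ c : ℂ, p * x * p = c • p := by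
  by_cases h : HasDoubling S
  · exact Or.inl h
  right
  simp only [HasDoubling, not_forall] at h
  obtain ⟨n, e, he, hno⟩ := h
  refine ⟨e, he.isStarProjection, he.ne_zero,
    hA.corner_scalar hmono hfin hSd he.isStarProjection he.mem fun m hm => ?_⟩
  refine (corner_commutative_or_exists_pair (S m) he.isStarProjection
    (hmono hm he.mem)).resolve_right fun hex => hno ⟨m, hm, hex⟩

end Dichotomy

/-! ### Compact operators on Hilbert spaces -/

section CompactOperators

variable {H : Type*} [NormedAddCommGroup H] [InnerProductSpace ℂ H]

theorem isCompactOperator_rankOne (x y : H) :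
    IsCompactOperator (InnerProductSpace.rankOne ℂ x y) := by
  have h : IsCompactOperator (innerSL ℂ y : H →L[ℂ] ℂ) :=
    ((isCompactOperator_id_iff_locallyCompactSpace (E := ℂ)).2 inferInstance).comp_clm (innerSL ℂ y)
  exact h.clm_comp (ContinuousLinearMap.toSpanSingleton ℂ x)

/-- Every compact operator on a Hilbert space is a norm limit of finite rank operators: compose it
with the projection onto the span of a finite net of the image of the unit ball. -/
theorem mem_closure_span_rankOne [CompleteSpace H] {T : H →L[ℂ] H} (hT : IsCompactOperator T) :
    T ∈ closure (Submodule.span ℂ {R : H →L[ℂ] H | ∃ x y, R = InnerProductSpace.rankOne ℂ x y} :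
      Set (H →L[ℂ] H)) := by
  rw [Metric.mem_closure_iff]
  intro ε hε
  have hK : IsCompact (closure (T '' Metric.closedBall 0 1)) :=
    hT.isCompact_closure_image_closedBall 1
  obtain ⟨t, ht, htfin, hcover⟩ := hK.finite_cover_balls (half_pos hε)
  let F : Submodule ℂ H := Submodule.span ℂ t
  have : FiniteDimensional ℂ F := FiniteDimensional.span_of_finite ℂ htfin
  let b := stdOrthonormalBasis ℂ F
  let R : H →L[ℂ] H := ∑ i, InnerProductSpace.rankOne ℂ (b i : H)
    (ContinuousLinearMap.adjoint T (b i : H))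
  have hR : ∀ x, R x = F.starProjection (T x) := by
    intro x
    rw [b.starProjection_eq_sum_rankOne]
    simp [R, ContinuousLinearMap.adjoint_inner_left]
  refine ⟨R, Submodule.sum_mem _ fun i _ => Submodule.subset_span ⟨_, _, rfl⟩, ?_⟩
  rw [dist_eq_norm]
  refine lt_of_le_of_lt ?_ (half_lt_self hε)
  refine ContinuousLinearMap.opNorm_le_of_unit_norm (half_pos hε).le fun x hx => ?_
  rw [sub_apply, hR]
  have hx' : T x ∈ closure (T '' Metric.closedBall 0 1) :=
    subset_closure ⟨x, by simp [hx], rfl⟩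
  obtain ⟨y, hy, hxy⟩ := Set.mem_iUnion₂.1 (hcover hx')
  rw [Metric.mem_ball, dist_eq_norm] at hxy
  refine le_trans ?_ hxy.le
  have hyF : y ∈ F := Submodule.subset_span hy
  rw [F.starProjection_minimal]
  exact ciInf_le ⟨0, by rintro _ ⟨z, rfl⟩; exact norm_nonneg _⟩ (⟨y, hyF⟩ : F)

/-- An orthonormal family in a separable Hilbert space is countable. -/
theorem Orthonormal.countable_of_separableSpace [TopologicalSpace.SeparableSpace H] {ι : Type*}
    {v : ι → H} (hv : Orthonormal ℂ v) : Countable ι := by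
  have hdist : ∀ i j, i ≠ j → (1 : ℝ) ≤ ‖v i - v j‖ := by
    intro i j hij
    have h1 : inner ℂ (v i) (v j) = 0 := hv.2 hij
    have h2 := norm_sub_sq (𝕜 := ℂ) (v i) (v j)
    rw [h1, hv.1, hv.1] at h2
    norm_num at h2
    nlinarith [norm_nonneg (v i - v j)]
  have hdisj : (Set.univ : Set ι).PairwiseDisjoint fun i => Metric.ball (v i) (1 / 2) := by
    intro i _ j _ hij
    refine Metric.ball_disjoint_ball ?_
    rw [dist_eq_norm]
    linarith [hdist i j hij]
  have := hdisj.countable_of_isOpen (fun i _ => Metric.isOpen_ball)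
    fun i _ => ⟨v i, Metric.mem_ball_self (by norm_num)⟩
  exact Set.countable_univ_iff.1 this

theorem exists_linearIsometryEquiv_ellTwo [CompleteSpace H] [TopologicalSpace.SeparableSpace H]
    (hinf : ¬ FiniteDimensional ℂ H) : Nonempty (H ≃ₗᵢ[ℂ] HilbertEllTwo) := by
  obtain ⟨w, b, hb⟩ := exists_hilbertBasis ℂ H
  have hc : Countable w := b.orthonormal.countable_of_separableSpace
  have hi : Infinite w := by
    by_contra hfin
    rw [not_infinite_iff_finite] at hfin
    have := Fintype.ofFinite w
    exact hinf (Module.Basis.finiteDimensional_of_finite b.toOrthonormalBasis.toBasis)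
  obtain ⟨e⟩ : Nonempty (w ≃ ℕ) := by
    obtain ⟨_⟩ := nonempty_denumerable w
    exact ⟨Denumerable.eqv w⟩
  have ho : Orthonormal ℂ (b ∘ e.symm) := b.orthonormal.comp _ e.symm.injective
  have hsp : ⊤ ≤ (Submodule.span ℂ (Set.range (b ∘ e.symm))).topologicalClosure := by
    rw [e.symm.surjective.range_comp, b.dense_span]
  exact ⟨(HilbertBasis.mk ho hsp).repr⟩

/-- A unitary operator induces an isomorphism between the spaces of compact operators. -/
theorem compactOperator_congr {H' : Type*} [NormedAddCommGroup H'] [InnerProductSpace ℂ H']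
    (V : H ≃ₗᵢ[ℂ] H') : Nonempty (compactOperator (RingHom.id ℂ) H H ≃L[ℂ]
      compactOperator (RingHom.id ℂ) H' H') := by
  let W : (H →L[ℂ] H) ≃L[ℂ] (H' →L[ℂ] H') :=
    V.toContinuousLinearEquiv.arrowCongr V.toContinuousLinearEquiv
  have hW : ∀ T : H →L[ℂ] H, IsCompactOperator T → IsCompactOperator (W T) := fun T hT =>
    (hT.comp_clm (V.symm.toContinuousLinearEquiv : H' →L[ℂ] H)).clm_comp
      (V.toContinuousLinearEquiv : H →L[ℂ] H')
  have hW' : ∀ T : H' →L[ℂ] H', IsCompactOperator T → IsCompactOperator (W.symm T) := fun T hT =>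
    (hT.comp_clm (V.toContinuousLinearEquiv : H →L[ℂ] H')).clm_comp
      (V.symm.toContinuousLinearEquiv : H' →L[ℂ] H)
  refine ⟨ContinuousLinearEquiv.equivOfInverse
    (((W : (H →L[ℂ] H) →L[ℂ] (H' →L[ℂ] H')).comp
      (compactOperator (RingHom.id ℂ) H H).subtypeL).codRestrict
        (compactOperator (RingHom.id ℂ) H' H') fun T => hW T T.2)
    (((W.symm : (H' →L[ℂ] H') →L[ℂ] (H →L[ℂ] H)).comp
      (compactOperator (RingHom.id ℂ) H' H').subtypeL).codRestrict
        (compactOperator (RingHom.id ℂ) H H) fun T => hW' T T.2)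
    (fun T => ?_) (fun T => ?_)⟩
  · exact Subtype.ext (W.symm_apply_apply T)
  · exact Subtype.ext (W.apply_symm_apply T)

end CompactOperators

/-! ### Simple C*-algebras with a minimal projection -/

section Elementary

variable {A : Type*} [NonUnitalCStarAlgebra A]

/-- The left ideal `A p`. -/
def leftIdeal (p : A) : Submodule ℂ A where
  carrier := {x | x * p = x}
  add_mem' := fun {x y} hx hy => by
    change (x + y) * p = x + y
    rw [add_mul, hx, hy]
  zero_mem' := zero_mul p
  smul_mem' := fun c x hx => by
    change (c • x) * p = c • x
    rw [smul_mul_assoc, hx]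

theorem mem_leftIdeal {p x : A} : x ∈ leftIdeal p ↔ x * p = x := Iff.rfl

theorem isClosed_leftIdeal (p : A) : IsClosed (leftIdeal p : Set A) :=
  isClosed_eq (by fun_prop) continuous_id

theorem star_mul_eq_smul {p : A} (hp : IsStarProjection p) (hp0 : p ≠ 0)
    (hpA : ∀ x : A, ∃ c : ℂ, p * x * p = c • p) {x y : A} (hx : x ∈ leftIdeal p)
    (hy : y ∈ leftIdeal p) : star x * y = dualCoordinate p (star x * y) • p := by
  have h1 : p * (star x * y) * p = star x * y := by
    have : p * star x = star x := by
      rw [← hp.isSelfAdjoint.star_eq, ← star_mul, hx]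
    rw [← mul_assoc, this, mul_assoc, hy]
  obtain ⟨c, hc⟩ := hpA (star x * y)
  rw [h1] at hc
  rw [hc, dualCoordinate_smul hp0]

/-- If `p A p` consists of scalars, the left ideal `A p` is a Hilbert space, with the norm of `A`
and with the inner product determined by `star x * y = ⟪x, y⟫ • p`. -/
@[reducible]
noncomputable def leftIdealInnerProductSpace {p : A} (hp : IsStarProjection p) (hp0 : p ≠ 0)
    (hpA : ∀ x : A, ∃ c : ℂ, p * x * p = c • p) : InnerProductSpace ℂ (leftIdeal p) :=
  { (inferInstance : NormedSpace ℂ (leftIdeal p)) with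
    inner := fun x y => dualCoordinate p (star (x : A) * y)
    norm_sq_eq_re_inner := fun x => by
      have h := star_mul_eq_smul hp hp0 hpA x.2 x.2
      obtain ⟨t, ht, hc⟩ := nonneg_of_star_mul_self_eq_smul hp hp0 h
      have hpn : ‖p‖ = 1 := by
        have := CStarRing.norm_star_mul_self (x := p)
        rw [hp.isSelfAdjoint.star_eq, hp.isIdempotentElem.eq] at this
        exact (mul_left_cancel₀ (norm_ne_zero_iff.2 hp0) (by rw [mul_one]; exact this)).symm
      change ‖(x : A)‖ ^ 2 = RCLike.re (dualCoordinate p (star (x : A) * x))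
      rw [sq, ← CStarRing.norm_star_mul_self, h, norm_smul, hpn, mul_one, ← h, hc]
      simp [abs_of_nonneg ht]
    conj_inner_symm := fun x y => by
      change star (dualCoordinate p (star (y : A) * x)) = dualCoordinate p (star (x : A) * y)
      have h := congrArg star (star_mul_eq_smul hp hp0 hpA y.2 x.2)
      rw [star_mul, star_star, star_smul, hp.isSelfAdjoint.star_eq] at h
      rw [h, dualCoordinate_smul hp0]
    add_left := fun x y z => by
      change dualCoordinate p (star ((x : A) + y) * z) = _
      rw [star_add, add_mul, map_add]
    smul_left := fun x y c => by
      change dualCoordinate p (star (c • (x : A)) * y) = _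
      rw [star_smul, smul_mul_assoc, map_smul]
      rfl }

/-- A simple C*-algebra is spanned by the products `x * star y` with `x`, `y` in a nonzero left
ideal `A p`. -/
theorem IsSimpleCStarAlgebra.mem_closure_span (hA : IsSimpleCStarAlgebra A) {p : A}
    (hp : IsStarProjection p) (hp0 : p ≠ 0) (a : A) :
    a ∈ closure (Submodule.span ℂ {z : A | ∃ x ∈ leftIdeal p, ∃ y ∈ leftIdeal p, z = x * star y} :
      Set A) := by
  set D := Submodule.span ℂ {z : A | ∃ x ∈ leftIdeal p, ∃ y ∈ leftIdeal p, z = x * star y} with hD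
  have hDl : ∀ b : A, D ≤ D.comap (LinearMap.mulLeft ℂ b) := fun b => by
    rw [hD, Submodule.span_le]
    rintro _ ⟨x, hx, y, hy, rfl⟩
    refine Submodule.subset_span ⟨b * x, ?_, y, hy, (mul_assoc _ _ _).symm⟩
    rw [mem_leftIdeal, mul_assoc, hx]
  have hDr : ∀ b : A, D ≤ D.comap (LinearMap.mulRight ℂ b) := fun b => by
    rw [hD, Submodule.span_le]
    rintro _ ⟨x, hx, y, hy, rfl⟩
    refine Submodule.subset_span ⟨x, hx, star b * y, ?_, ?_⟩
    · rw [mem_leftIdeal, mul_assoc, hy]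
    · simp [mul_assoc]
  have hideal : ∀ b : A, ∀ x ∈ D.topologicalClosure,
      b * x ∈ D.topologicalClosure ∧ x * b ∈ D.topologicalClosure := fun b x hx =>
    ⟨map_mem_closure (f := fun x => b * x) (by fun_prop) hx fun y hy => hDl b hy,
      map_mem_closure (f := fun x => x * b) (by fun_prop) hx fun y hy => hDr b hy⟩
  have hpD : p ∈ D.topologicalClosure := by
    refine D.le_topologicalClosure (Submodule.subset_span ⟨p, hp.isIdempotentElem, p,
      hp.isIdempotentElem, ?_⟩)
    rw [hp.isSelfAdjoint.star_eq, hp.isIdempotentElem.eq]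
  rcases hA.2 _ D.isClosed_topologicalClosure hideal with h | h
  · rw [h] at hpD
    exact absurd ((Submodule.mem_bot ℂ).1 hpD) hp0
  · have : a ∈ D.topologicalClosure := h ▸ Submodule.mem_top
    exact this

section Representation

variable {H : Type*} [NormedAddCommGroup H] [InnerProductSpace ℂ H] {p : A}

theorem IsSimpleCStarAlgebra.mem_closure_span_range (hA : IsSimpleCStarAlgebra A)
    (hp : IsStarProjection p) (hp0 : p ≠ 0) (ι : H →ₗᵢ[ℂ] A)
    (hι' : ∀ y, y * p = y → ∃ x, ι x = y) (a : A) :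
    a ∈ closure (Submodule.span ℂ {z : A | ∃ x y, z = ι x * star (ι y)} : Set A) := by
  refine closure_mono (Submodule.span_mono ?_) (hA.mem_closure_span hp hp0 a)
  rintro _ ⟨x, hx, y, hy, rfl⟩
  obtain ⟨x', rfl⟩ := hι' x hx
  obtain ⟨y', rfl⟩ := hι' y hy
  exact ⟨x', y', rfl⟩

variable [CompleteSpace H]

/-- Let the Hilbert space `H` be identified with the left ideal `A p` by means of a map `ι` for
which `star (ι x) * ι y = ⟪x, y⟫ • p`. Then left multiplication is a representation of `A`. -/
theorem exists_representation_of_leftIdeal (hp0 : p ≠ 0)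
    (ι : H →ₗᵢ[ℂ] A) (hι : ∀ x, ι x * p = ι x) (hι' : ∀ y, y * p = y → ∃ x, ι x = y)
    (hinner : ∀ x y, star (ι x) * ι y = inner ℂ x y • p) :
    ∃ ρ : A →⋆ₙₐ[ℂ] (H →L[ℂ] H), ∀ a x, ι (ρ a x) = a * ι x := by
  have hp_inj : ∀ c d : ℂ, c • p = d • p → c = d := fun c d h => smul_left_injective ℂ hp0 h
  choose m hm using fun (a : A) (x : H) => hι' (a * ι x) (by rw [mul_assoc, hι])
  let L : A → (H →L[ℂ] H) := fun a => LinearMap.mkContinuous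
    { toFun := m a
      map_add' := fun x y => ι.injective (by simp only [map_add, hm, mul_add])
      map_smul' := fun c x => ι.injective (by
        simp only [map_smul, hm, mul_smul_comm, RingHom.id_apply]) }
    ‖a‖ fun x => by
      rw [← ι.norm_map x, ← ι.norm_map]
      change ‖ι (m a x)‖ ≤ _
      rw [hm]
      exact norm_mul_le _ _
  have hL : ∀ a x, ι (L a x) = a * ι x := hm
  let ρ : A →⋆ₙₐ[ℂ] (H →L[ℂ] H) :=
    { toFun := L
      map_smul' := fun c a => ContinuousLinearMap.ext fun x => ι.injective (by
        simp [hL, smul_mul_assoc])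
      map_zero' := ContinuousLinearMap.ext fun x => ι.injective (by simp [hL])
      map_add' := fun a b => ContinuousLinearMap.ext fun x => ι.injective (by simp [hL, add_mul])
      map_mul' := fun a b => ContinuousLinearMap.ext fun x => ι.injective (by
        change ι (L (a * b) x) = ι (L a (L b x))
        rw [hL, hL, hL, mul_assoc])
      map_star' := fun a => by
        rw [ContinuousLinearMap.star_eq_adjoint, ContinuousLinearMap.eq_adjoint_iff]
        intro x y
        apply hp_inj
        rw [← hinner, ← hinner, hL, hL, star_mul, star_star, mul_assoc] }
  exact ⟨ρ, hL⟩

/-- The representation of a simple C*-algebra on a left ideal `A p` is isometric, and it maps the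
products `ι x * star (ι y)` to the operators of rank one. -/
theorem IsSimpleCStarAlgebra.exists_isometric_representation
    (hA : IsSimpleCStarAlgebra A) (hp : IsStarProjection p) (hp0 : p ≠ 0)
    (ι : H →ₗᵢ[ℂ] A) (hι : ∀ x, ι x * p = ι x) (hι' : ∀ y, y * p = y → ∃ x, ι x = y)
    (hinner : ∀ x y, star (ι x) * ι y = inner ℂ x y • p) :
    ∃ ρ : A →ₗᵢ[ℂ] (H →L[ℂ] H),
      ∀ x y, ρ (ι x * star (ι y)) = InnerProductSpace.rankOne ℂ x y := by
  obtain ⟨ρ, hρ⟩ := exists_representation_of_leftIdeal hp0 ι hι hι' hinner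
  have hrank : ∀ x y, ρ (ι x * star (ι y)) = InnerProductSpace.rankOne ℂ x y := by
    intro x y
    refine ContinuousLinearMap.ext fun z => ι.injective ?_
    rw [hρ, mul_assoc, hinner, mul_smul_comm, hι, InnerProductSpace.rankOne_apply, map_smul]
  have hspan := hA.mem_closure_span_range hp hp0 ι hι'
  -- The kernel of `ρ` is orthogonal to the dense ideal spanned by the products `ι x * star (ι y)`.
  have hinj : Function.Injective ρ := by
    rw [injective_iff_map_eq_zero]
    intro a ha
    have hax : ∀ x, a * ι x = 0 := fun x => by rw [← hρ, ha]; simp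
    have h0 : ∀ b : A, a * b = 0 := by
      intro b
      have hcl : IsClosed {b : A | a * b = 0} := isClosed_eq (by fun_prop) continuous_const
      refine hcl.closure_subset_iff.2 ?_ (hspan b)
      have hle : Submodule.span ℂ {z : A | ∃ x y, z = ι x * star (ι y)} ≤
          LinearMap.ker (LinearMap.mulLeft ℂ a) := by
        rw [Submodule.span_le]
        rintro _ ⟨x, y, rfl⟩
        change a * (ι x * star (ι y)) = 0
        rw [← mul_assoc, hax x, zero_mul]
      exact fun z hz => hle hz
    have h1 := h0 (star a)
    exact star_eq_zero.1 (star_mul_self_eq_zero' (by rwa [star_star]))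
  have hnorm : ∀ a, ‖ρ a‖ = ‖a‖ := NonUnitalStarAlgHom.norm_map ρ hinj
  exact ⟨⟨(ρ : A →ₗ[ℂ] _), hnorm⟩, hrank⟩

/-- The image of the isometric representation on `A p` is closed, so it is the closed span of the
rank-one operators, that is, the space of compact operators. -/
theorem IsSimpleCStarAlgebra.nonempty_equiv_compactOperator_of_leftIdeal
    (hA : IsSimpleCStarAlgebra A) (hp : IsStarProjection p) (hp0 : p ≠ 0)
    (ι : H →ₗᵢ[ℂ] A) (hι : ∀ x, ι x * p = ι x) (hι' : ∀ y, y * p = y → ∃ x, ι x = y)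
    (hinner : ∀ x y, star (ι x) * ι y = inner ℂ x y • p) :
    Nonempty (A ≃L[ℂ] compactOperator (RingHom.id ℂ) H H) := by
  obtain ⟨ρ, hrank⟩ := hA.exists_isometric_representation hp hp0 ι hι hι' hinner
  have hspan := hA.mem_closure_span_range hp hp0 ι hι'
  have hcompact : ∀ a, ρ.toLinearMap a ∈ compactOperator (RingHom.id ℂ) H H := by
    intro a
    have hcl : IsClosed {b : A | IsCompactOperator (ρ b)} :=
      (isClosed_setOfPred_isCompactOperator (σ₁₂ := RingHom.id ℂ) (M₁ := H)
        (M₂ := H)).preimage ρ.continuous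
    refine hcl.closure_subset_iff.2 ?_ (hspan a)
    have hle : Submodule.span ℂ {z : A | ∃ x y, z = ι x * star (ι y)} ≤
        (compactOperator (RingHom.id ℂ) H H).comap ρ.toLinearMap := by
      rw [Submodule.span_le]
      rintro _ ⟨x, y, rfl⟩
      change IsCompactOperator (ρ (ι x * star (ι y)))
      rw [hrank]
      exact isCompactOperator_rankOne _ _
    exact fun z hz => hle hz
  have hsurj : ∀ T : H →L[ℂ] H, IsCompactOperator T → ∃ a, ρ a = T := by
    intro T hT
    have hcl : IsClosed (Set.range ρ) := ρ.isometry.isClosedEmbedding.isClosed_range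
    refine hcl.closure_subset_iff.2 ?_ (mem_closure_span_rankOne hT)
    have hle : Submodule.span ℂ {R : H →L[ℂ] H |
        ∃ x y, R = InnerProductSpace.rankOne ℂ x y} ≤ LinearMap.range ρ.toLinearMap := by
      rw [Submodule.span_le]
      rintro _ ⟨x, y, rfl⟩
      exact ⟨_, hrank x y⟩
    exact fun z hz => hle hz
  let ψ : A →ₗᵢ[ℂ] compactOperator (RingHom.id ℂ) H H :=
    ⟨ρ.toLinearMap.codRestrict _ hcompact, ρ.norm_map⟩
  have hψ : Function.Surjective ψ := fun T => by
    obtain ⟨a, ha⟩ := hsurj T T.2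
    exact ⟨a, Subtype.ext ha⟩
  exact ⟨(LinearIsometryEquiv.ofSurjective ψ hψ).toContinuousLinearEquiv⟩

end Representation

theorem IsSimpleCStarAlgebra.nonempty_equiv_compactOperatorAlgebra
    [TopologicalSpace.SeparableSpace A]
    (hA : IsSimpleCStarAlgebra A) (hinf : ¬ FiniteDimensional ℂ A) {p : A}
    (hp : IsStarProjection p) (hp0 : p ≠ 0) (hpA : ∀ x : A, ∃ c : ℂ, p * x * p = c • p) :
    Nonempty (A ≃L[ℂ] CompactOperatorAlgebra) := by
  let _ : InnerProductSpace ℂ (leftIdeal p) := leftIdealInnerProductSpace hp hp0 hpA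
  have _ : CompleteSpace (leftIdeal p) := (isClosed_leftIdeal p).completeSpace_coe
  obtain ⟨W⟩ := hA.nonempty_equiv_compactOperator_of_leftIdeal hp hp0
    (leftIdeal p).subtypeₗᵢ (fun x => x.2) (fun y hy => ⟨⟨y, hy⟩, rfl⟩)
    fun x y => star_mul_eq_smul hp hp0 hpA x.2 y.2
  have hHinf : ¬ FiniteDimensional ℂ (leftIdeal p) := fun hfd => by
    have : Module.Finite ℂ (leftIdeal p →L[ℂ] leftIdeal p) := inferInstance
    exact hinf (FiniteDimensional.of_injective
      ((compactOperator (RingHom.id ℂ) (leftIdeal p) (leftIdeal p)).subtype ∘ₗ W.toLinearMap)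
      (Subtype.val_injective.comp W.injective))
  obtain ⟨V⟩ := exists_linearIsometryEquiv_ellTwo hHinf
  obtain ⟨W'⟩ := compactOperator_congr V
  exact ⟨W.trans W'⟩

theorem IsAFAlgebra.separableSpace (hA : IsAFAlgebra A) : TopologicalSpace.SeparableSpace A := by
  obtain ⟨S, -, hfin, hd⟩ := hA
  have hsep : TopologicalSpace.IsSeparable (⋃ n, (S n : Set A)) := by
    refine TopologicalSpace.IsSeparable.iUnion fun n => ?_
    have := hfin n
    have : ProperSpace (S n) := FiniteDimensional.proper ℂ (S n)
    exact TopologicalSpace.IsSeparable.of_subtype (S n : Set A)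
  have := hsep.closure
  rw [hd.closure_eq] at this
  exact TopologicalSpace.isSeparable_univ_iff.1 this

end Elementary

/-! ### The decomposition method -/

section DecompositionMethod

open Filter Topology ZeroAtInfty

variable {X V : Type*} [NormedAddCommGroup X]

/-- The null sequence with the given terms. -/
def nullSequence (f : ℕ → X) (hf : Tendsto f atTop (𝓝 0)) : C₀(ℕ, X) where
  toFun := f
  continuous_toFun := continuous_of_discreteTopology
  zero_at_infty' := by
    rwa [cocompact_eq_cofinite, Nat.cofinite_eq_atTop]

theorem tendsto_nullSequence (f : C₀(ℕ, X)) : Tendsto f atTop (𝓝 0) := by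
  have := f.zero_at_infty'
  rwa [cocompact_eq_cofinite, Nat.cofinite_eq_atTop] at this

theorem norm_apply_le (f : C₀(ℕ, X)) (n : ℕ) : ‖f n‖ ≤ ‖f‖ := by
  rw [← ZeroAtInftyContinuousMap.norm_toBCF_eq_norm]
  exact f.toBCF.norm_coe_le_norm n

theorem norm_le_of_forall_le (f : C₀(ℕ, X)) {c : ℝ} (hc : 0 ≤ c) (h : ∀ n, ‖f n‖ ≤ c) :
    ‖f‖ ≤ c := by
  rw [← ZeroAtInftyContinuousMap.norm_toBCF_eq_norm]
  exact (BoundedContinuousFunction.norm_le hc).2 h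

variable [NormedSpace ℂ X] [NormedAddCommGroup V] [NormedSpace ℂ V]

/-- A uniformly bounded sequence of linear maps which tends to zero pointwise defines an operator
into the space of null sequences. -/
theorem exists_clm_nullSequence (Φ : ℕ → V →ₗ[ℂ] X) (h0 : ∀ v, Tendsto (fun n => Φ n v) atTop (𝓝 0))
    (c : ℝ) (hc : ∀ n v, ‖Φ n v‖ ≤ c * ‖v‖) : ∃ T : V →L[ℂ] C₀(ℕ, X), ∀ v n, T v n = Φ n v := by
  refine ⟨LinearMap.mkContinuous
    { toFun := fun v => nullSequence (fun n => Φ n v) (h0 v)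
      map_add' := fun v w => ZeroAtInftyContinuousMap.ext fun n => map_add (Φ n) v w
      map_smul' := fun a v => ZeroAtInftyContinuousMap.ext fun n => map_smul (Φ n) a v }
    c fun v => ?_, fun v n => rfl⟩
  exact norm_le_of_forall_le _ ((norm_nonneg _).trans (hc 0 v)) fun n => hc n v

/-- Evaluation at an index. -/
noncomputable def nullEval (n : ℕ) : C₀(ℕ, X) →L[ℂ] X :=
  LinearMap.mkContinuous
    { toFun := fun f => f n
      map_add' := fun _ _ => rfl
      map_smul' := fun _ _ => rfl } 1 fun f => by rw [one_mul]; exact norm_apply_le f n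

/-- A complemented subspace of `X` is absorbed by the space of null sequences in `X`: the
complemented copy of `E` in the first coordinate is pushed one coordinate further at each step. -/
theorem IsComplementedIn.prod_equiv {E : Type*} [NormedAddCommGroup E] [NormedSpace ℂ E]
    (h : IsComplementedIn E X) : Nonempty ((E × C₀(ℕ, X)) ≃L[ℂ] C₀(ℕ, X)) := by
  obtain ⟨J, S, hSJ⟩ := h
  let p : X →L[ℂ] X := J.comp S
  have hp : ∀ x, p x = J (S x) := fun x => rfl
  have hbd : ∀ (x y : X) (M : ℝ), ‖x‖ ≤ M → ‖y‖ ≤ M → ‖p x + (y - p y)‖ ≤ (2 * ‖p‖ + 1) * M := by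
    intro x y M hx hy
    have h1 : ‖p x‖ ≤ ‖p‖ * M := (p.le_opNorm x).trans (by gcongr)
    have h2 : ‖p y‖ ≤ ‖p‖ * M := (p.le_opNorm y).trans (by gcongr)
    linarith [norm_add_le (p x) (y - p y), norm_sub_le y (p y)]
  have hp0 : ∀ f : ℕ → X, Tendsto f atTop (𝓝 0) → Tendsto (fun n => p (f n)) atTop (𝓝 0) :=
    fun f hf => by
      have := (p.continuous.tendsto 0).comp hf
      rwa [map_zero] at this
  let Φ : ℕ → (E × C₀(ℕ, X)) →L[ℂ] X := fun n => Nat.casesOn n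
    (J.comp (.fst ℂ E _) + (nullEval 0 - p.comp (nullEval 0)).comp (.snd ℂ E _))
    fun n => (p.comp (nullEval n) + (nullEval (n + 1) - p.comp (nullEval (n + 1)))).comp
      (.snd ℂ E _)
  have hΦ0 : ∀ v, Φ 0 v = J v.1 + (v.2 0 - p (v.2 0)) := fun v => rfl
  have hΦs : ∀ n v, Φ (n + 1) v = p (v.2 n) + (v.2 (n + 1) - p (v.2 (n + 1))) := fun n v => rfl
  have hn : ∀ (v : E × C₀(ℕ, X)) n, ‖v.2 n‖ ≤ ‖v‖ := fun v n =>
    (norm_apply_le _ _).trans (norm_snd_le v)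
  obtain ⟨T, hT⟩ := exists_clm_nullSequence (fun n => (Φ n).toLinearMap)
    (fun v => by
      rw [← tendsto_add_atTop_iff_nat 1]
      have h1 := tendsto_nullSequence v.2
      have h2 := h1.comp (tendsto_add_atTop_nat 1)
      have h3 := (hp0 _ h1).add (h2.sub (hp0 _ h2))
      rw [sub_zero, add_zero] at h3
      exact h3)
    (max (‖Φ 0‖) (2 * ‖p‖ + 1)) (by
      rintro (_ | n) v
      · exact ((Φ 0).le_opNorm v).trans (mul_le_mul_of_nonneg_right (le_max_left _ _) (norm_nonneg v))
      · refine (hbd _ _ _ (hn v n) (hn v (n + 1))).trans ?_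
        gcongr
        exact le_max_right _ _)
  let Ψ : ℕ → C₀(ℕ, X) →L[ℂ] X := fun n =>
    p.comp (nullEval (n + 1)) + (nullEval n - p.comp (nullEval n))
  have hΨ : ∀ n g, Ψ n g = p (g (n + 1)) + (g n - p (g n)) := fun n g => rfl
  obtain ⟨T', hT'⟩ := exists_clm_nullSequence (fun n => (Ψ n).toLinearMap)
    (fun g => by
      have h1 := tendsto_nullSequence g
      have h2 := h1.comp (tendsto_add_atTop_nat 1)
      have h3 := (hp0 _ h2).add (h1.sub (hp0 _ h1))
      rw [sub_zero, add_zero] at h3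
      exact h3)
    (2 * ‖p‖ + 1) (fun n g => hbd _ _ _ (norm_apply_le g _) (norm_apply_le g _))
  have hpp : ∀ x, p (p x) = p x := fun x => by rw [hp, hp, hSJ]
  have hpJ : ∀ x, p (J x) = J x := fun x => by rw [hp, hSJ]
  have hSp : ∀ x, S (p x) = S x := fun x => by rw [hp, hSJ]
  refine ⟨ContinuousLinearEquiv.equivOfInverse T ((S.comp (nullEval 0)).prod T') ?_ ?_⟩
  · intro v
    refine Prod.ext ?_ (ZeroAtInftyContinuousMap.ext fun n => ?_)
    · change S (T v 0) = v.1
      rw [hT]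
      change S (Φ 0 v) = v.1
      rw [hΦ0, map_add, map_sub, hSp, hSJ, sub_self, add_zero]
    · change T' (T v) n = v.2 n
      rw [hT']
      change Ψ n (T v) = v.2 n
      rw [hΨ, hT, hT]
      cases n with
      | zero =>
        change p (Φ (0 + 1) v) + (Φ 0 v - p (Φ 0 v)) = _
        rw [hΦs, hΦ0]
        simp only [map_add, map_sub, hpp, hpJ]
        abel
      | succ n =>
        change p (Φ (n + 2) v) + (Φ (n + 1) v - p (Φ (n + 1) v)) = _
        rw [hΦs, hΦs]
        simp only [map_add, map_sub, hpp]
        abel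
  · intro g
    refine ZeroAtInftyContinuousMap.ext fun n => ?_
    rw [hT]
    change Φ n (S (g 0), T' g) = g n
    cases n with
    | zero =>
      rw [hΦ0]
      change J (S (g 0)) + (T' g 0 - p (T' g 0)) = _
      rw [hT', ← hp]
      change p (g 0) + (Ψ 0 g - p (Ψ 0 g)) = _
      rw [hΨ]
      simp only [map_add, map_sub, hpp]
      abel
    | succ n =>
      rw [hΦs]
      change p (T' g n) + (T' g (n + 1) - p (T' g (n + 1))) = _
      rw [hT', hT']
      change p (Ψ n g) + (Ψ (n + 1) g - p (Ψ (n + 1) g)) = _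
      rw [hΨ, hΨ]
      simp only [map_add, map_sub, hpp]
      abel

/-- A complemented subspace which is isomorphic to its square can be split off once more. -/
theorem IsComplementedIn.equiv_prod {D : Type*} [NormedAddCommGroup D] [NormedSpace ℂ D]
    (h : IsComplementedIn D X) (θ : (D × D) ≃L[ℂ] D) : Nonempty (X ≃L[ℂ] X × D) := by
  obtain ⟨J, T, hTJ⟩ := h
  let σ : D →L[ℂ] D × D := θ.symm
  let τ : D × D →L[ℂ] D := θ
  have hτσ : ∀ d, τ (σ d) = d := θ.apply_symm_apply
  have hστ : ∀ d, σ (τ d) = d := θ.symm_apply_apply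
  let F : X →L[ℂ] X × D :=
    ((.id ℂ X - J.comp T) + J.comp ((ContinuousLinearMap.fst ℂ D D).comp (σ.comp T))).prod
      ((ContinuousLinearMap.snd ℂ D D).comp (σ.comp T))
  let G : X × D →L[ℂ] X :=
    (.id ℂ X - J.comp T).comp (.fst ℂ X D) +
      J.comp (τ.comp ((T.comp (.fst ℂ X D)).prod (.snd ℂ X D)))
  have hF : ∀ x, F x = ((x - J (T x)) + J (σ (T x)).1, (σ (T x)).2) := fun x => rfl
  have hG : ∀ z, G z = (z.1 - J (T z.1)) + J (τ (T z.1, z.2)) := fun z => rfl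
  refine ⟨ContinuousLinearEquiv.equivOfInverse F G (fun x => ?_) (fun z => ?_)⟩
  · rw [hG, hF]
    simp only [map_add, map_sub, hTJ, hτσ, sub_self, zero_add]
    abel
  · have h1 : T (G z) = τ (T z.1, z.2) := by
      rw [hG]; simp only [map_add, map_sub, hTJ, sub_self, zero_add]
    rw [hF, h1, hστ, hG]
    refine Prod.ext ?_ rfl
    simp

/-- Pełczyński's decomposition method. -/
theorem nonempty_equiv_nullSequences {A : Type*} [NormedAddCommGroup A] [NormedSpace ℂ A]
    (hX : IsComplementedIn C₀(ℕ, X) X) (hAX : IsComplementedIn A X) (hXA : IsComplementedIn X A) :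
    Nonempty (A ≃L[ℂ] C₀(ℕ, X)) := by
  obtain ⟨θ⟩ := hX.prod_equiv
  obtain ⟨e⟩ := hAX.prod_equiv
  obtain ⟨e'⟩ := (hX.trans hXA).equiv_prod θ
  exact ⟨e'.trans e⟩

end DecompositionMethod

/-! ### Null sequences in an AF-algebra -/

section NullSequencesAF

open Filter Topology ZeroAtInfty

variable {B : Type*} [NonUnitalCStarAlgebra B]

/-- The null sequences with values in `N` which vanish from the index `n` on. -/
def finiteSequences (N : NonUnitalStarSubalgebra ℂ B) (n : ℕ) :
    NonUnitalStarSubalgebra ℂ C₀(ℕ, B) where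
  carrier := {f | (∀ k, f k ∈ N) ∧ ∀ k, n ≤ k → f k = 0}
  add_mem' := fun {f g} hf hg => ⟨fun k => add_mem (hf.1 k) (hg.1 k), fun k hk => by
    change f k + g k = 0
    rw [hf.2 k hk, hg.2 k hk, add_zero]⟩
  zero_mem' := ⟨fun _ => zero_mem N, fun _ _ => rfl⟩
  mul_mem' := fun {f g} hf hg => ⟨fun k => mul_mem (hf.1 k) (hg.1 k), fun k hk => by
    change f k * g k = 0
    rw [hf.2 k hk, zero_mul]⟩
  smul_mem' := fun c f hf => ⟨fun k => SMulMemClass.smul_mem c (hf.1 k), fun k hk => by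
    change c • f k = 0
    rw [hf.2 k hk, smul_zero]⟩
  star_mem' := fun {f} hf => ⟨fun k => star_mem (hf.1 k), fun k hk => by
    change star (f k) = 0
    rw [hf.2 k hk, star_zero]⟩

instance (N : NonUnitalStarSubalgebra ℂ B) (n : ℕ) [FiniteDimensional ℂ N] :
    FiniteDimensional ℂ (finiteSequences N n) := by
  let φ : finiteSequences N n →ₗ[ℂ] (Fin n → N) :=
    { toFun := fun f k => ⟨f.1 k, f.2.1 k⟩
      map_add' := fun f g => rfl
      map_smul' := fun c f => rfl }
  refine FiniteDimensional.of_injective φ fun f g hfg =>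
    Subtype.ext (ZeroAtInftyContinuousMap.ext fun k => ?_)
  rcases lt_or_ge k n with hk | hk
  · exact congrArg Subtype.val (congrFun hfg ⟨k, hk⟩)
  · rw [f.2.2 k hk, g.2.2 k hk]

theorem IsAFAlgebra.nullSequences (hB : IsAFAlgebra B) : IsAFAlgebra C₀(ℕ, B) := by
  obtain ⟨N, hN, hfin, hd⟩ := hB
  refine ⟨fun n => finiteSequences (N n) n, fun m n hmn f hf =>
    ⟨fun k => hN hmn (hf.1 k), fun k hk => hf.2 k (hmn.trans hk)⟩, fun n => ?_, fun f => ?_⟩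
  · have := hfin n
    infer_instance
  rw [Metric.mem_closure_iff]
  intro ε hε
  obtain ⟨n, hn⟩ := (Metric.tendsto_atTop.1 (tendsto_nullSequence f)) (ε / 2) (half_pos hε)
  have happrox : ∀ k, ∃ y m, y ∈ N m ∧ dist (f k) y < ε / 2 := fun k => by
    obtain ⟨y, hy, hyk⟩ := Metric.mem_closure_iff.1 (hd (f k)) (ε / 2) (half_pos hε)
    obtain ⟨m, hm⟩ := Set.mem_iUnion.1 hy
    exact ⟨y, m, hm, hyk⟩
  choose y m hym hy using happrox
  let M := max n ((Finset.range n).sup m)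
  let g : C₀(ℕ, B) := nullSequence (fun k => if k < n then y k else 0)
    (tendsto_const_nhds.congr' (eventually_atTop.2 ⟨n, fun k hk => (if_neg hk.not_gt).symm⟩))
  have hg : ∀ k, g k = if k < n then y k else 0 := fun k => rfl
  refine ⟨g, Set.mem_iUnion.2 ⟨M, fun k => ?_, fun k hk => ?_⟩, ?_⟩
  · rw [hg]
    split_ifs with hk
    · exact hN ((Finset.le_sup (Finset.mem_range.2 hk)).trans (le_max_right _ _)) (hym k)
    · exact zero_mem _
  · rw [hg, if_neg (((le_max_left _ _).trans hk).not_gt)]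
  · rw [dist_eq_norm]
    refine (norm_le_of_forall_le _ (half_pos hε).le fun k => ?_).trans_lt (half_lt_self hε)
    change ‖f k - g k‖ ≤ ε / 2
    rw [hg, ← dist_eq_norm]
    split_ifs with hk
    · exact (hy k).le
    · exact (hn k (not_lt.1 hk)).le

end NullSequencesAF

/-! ### The Fermion algebra -/

section Fermion

open Matrix ZeroAtInfty

theorem isClosed_fermionAlgebra :
    IsClosed (FermionAlgebra : Set (HilbertEllTwo →L[ℂ] HilbertEllTwo)) :=
  StarSubalgebra.isClosed_topologicalClosure _

attribute [local instance] isClosed_fermionAlgebra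

theorem fermionRep_mem (n : ℕ) (a : Matrix (Fin (2 ^ n)) (Fin (2 ^ n)) ℂ) :
    fermionRep n a ∈ FermionAlgebra := by
  rw [← SetLike.mem_coe, coe_fermionAlgebra]
  exact subset_closure (Set.mem_iUnion.2 ⟨n, a, rfl⟩)

/-- The embedding of `M_{2^n}` into the Fermion algebra. -/
noncomputable def fermionEmbedding (n : ℕ) :
    Matrix (Fin (2 ^ n)) (Fin (2 ^ n)) ℂ →⋆ₐ[ℂ] FermionAlgebra :=
  (fermionRep n).codRestrict FermionAlgebra (fermionRep_mem n)

theorem fermionEmbedding_doubleMatrix (n : ℕ) (a : Matrix (Fin (2 ^ n)) (Fin (2 ^ n)) ℂ) :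
    fermionEmbedding (n + 1) (doubleMatrix n a) = fermionEmbedding n a :=
  Subtype.ext (fermionRep_doubleMatrix n a)

instance : Nontrivial FermionAlgebra := by
  refine ⟨1, 0, fun h => ?_⟩
  have h1 : (1 : HilbertEllTwo →L[ℂ] HilbertEllTwo) = 0 := congrArg Subtype.val h
  have h2 : basisVec 0 = 0 := congrArg (fun T => T (basisVec 0)) h1
  simpa [h2] using inner_basisVec 0 0

theorem fermionEmbedding_injective (n : ℕ) : Function.Injective (fermionEmbedding n) := by
  have : Nonempty (Fin (2 ^ n)) := ⟨⟨0, by positivity⟩⟩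
  exact RingHom.injective ((fermionEmbedding n).toAlgHom.toRingHom)

/-- The copy of `M_{2^n}` in the Fermion algebra. -/
noncomputable def fermionSubalgebra (n : ℕ) : NonUnitalStarSubalgebra ℂ FermionAlgebra :=
  NonUnitalStarAlgHom.range (fermionEmbedding n)

theorem fermionSubalgebra_mono : Monotone fermionSubalgebra := by
  refine monotone_nat_of_le_succ fun n => ?_
  rintro _ ⟨a, rfl⟩
  exact ⟨doubleMatrix n a, fermionEmbedding_doubleMatrix n a⟩

instance (n : ℕ) : FiniteDimensional ℂ (fermionSubalgebra n) := by
  let φ : Matrix (Fin (2 ^ n)) (Fin (2 ^ n)) ℂ →ₗ[ℂ] fermionSubalgebra n :=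
    { toFun := fun a => ⟨fermionEmbedding n a, a, rfl⟩
      map_add' := fun a b => Subtype.ext (map_add _ a b)
      map_smul' := fun c a => Subtype.ext (map_smul _ c a) }
  refine FiniteDimensional.of_surjective φ ?_
  rintro ⟨_, a, rfl⟩
  exact ⟨a, rfl⟩

theorem dense_fermionSubalgebra : Dense (⋃ n, (fermionSubalgebra n : Set FermionAlgebra)) := by
  intro x
  rw [closure_subtype]
  have hx : (x : HilbertEllTwo →L[ℂ] HilbertEllTwo) ∈ closure (⋃ k, Set.range (fermionRep k)) := by
    rw [← coe_fermionAlgebra]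
    exact x.2
  refine closure_mono ?_ hx
  rintro _ hy
  obtain ⟨n, a, rfl⟩ := Set.mem_iUnion.1 hy
  exact ⟨fermionEmbedding n a, Set.mem_iUnion.2 ⟨n, a, rfl⟩, rfl⟩

theorem isAFAlgebra_fermionAlgebra : IsAFAlgebra FermionAlgebra :=
  ⟨fermionSubalgebra, fermionSubalgebra_mono, fun _ => inferInstance, dense_fermionSubalgebra⟩

/-- The index `j` of the `i`-th diagonal block of `M_{2^(n+1)}`. -/
def blockIndex (n : ℕ) : Fin 2 × Fin (2 ^ n) ≃ Fin (2 ^ (n + 1)) :=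
  finProdFinEquiv.trans (finCongr (pow_succ' 2 n).symm)

theorem doubleMatrix_blockIndex (n : ℕ) (a : Matrix (Fin (2 ^ n)) (Fin (2 ^ n)) ℂ)
    (i k : Fin 2) (j l : Fin (2 ^ n)) :
    doubleMatrix n a (blockIndex n (i, j)) (blockIndex n (k, l)) =
      if i = k then a j l else 0 := by
  have hdiv : ∀ (i : Fin 2) (j : Fin (2 ^ n)), (blockIndex n (i, j) : ℕ) / 2 ^ n = i := fun i j => by
    change ((j : ℕ) + 2 ^ n * i) / 2 ^ n = i
    rw [Nat.add_mul_div_left _ _ (by positivity), Nat.div_eq_of_lt j.2, zero_add]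
  have hmod : ∀ (i : Fin 2) (j : Fin (2 ^ n)), (blockIndex n (i, j) : ℕ) % 2 ^ n = j := fun i j => by
    change ((j : ℕ) + 2 ^ n * i) % 2 ^ n = j
    rw [Nat.add_mul_mod_self_left, Nat.mod_eq_of_lt j.2]
  simp only [doubleMatrix, hdiv, hmod, Fin.ext_iff]

/-- A unit vector fixed by `a` gives one in each diagonal block of `diag(a, a)`, and these two are
orthogonal. -/
theorem exists_doubleMatrix_fixed {n : ℕ} {a : Matrix (Fin (2 ^ n)) (Fin (2 ^ n)) ℂ}
    {ξ : Fin (2 ^ n) → ℂ} (hξ : a *ᵥ ξ = ξ) (h1 : star ξ ⬝ᵥ ξ = 1) :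
    ∃ v : Fin 2 → Fin (2 ^ (n + 1)) → ℂ, (∀ l, doubleMatrix n a *ᵥ v l = v l) ∧
      ∀ l k, star (v l) ⬝ᵥ v k = if l = k then 1 else 0 := by
  let v : Fin 2 → Fin (2 ^ (n + 1)) → ℂ := fun l p =>
    if ((blockIndex n).symm p).1 = l then ξ ((blockIndex n).symm p).2 else 0
  have hv : ∀ l i j, v l (blockIndex n (i, j)) = if i = l then ξ j else 0 := fun l i j => by
    simp [v]
  refine ⟨v, fun l => funext fun p => ?_, fun l k => ?_⟩
  · obtain ⟨⟨i, j⟩, rfl⟩ := (blockIndex n).surjective p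
    rw [Matrix.mulVec, dotProduct, ← (blockIndex n).sum_comp, Fintype.sum_prod_type, hv]
    simp only [doubleMatrix_blockIndex, hv]
    rw [Finset.sum_eq_single i (fun k _ hk => Finset.sum_eq_zero fun q _ => by
      rw [if_neg (Ne.symm hk), zero_mul]) (by simp)]
    by_cases hil : i = l
    · simpa [hil, Matrix.mulVec, dotProduct] using congrFun hξ j
    · simp [hil]
  · rw [dotProduct, ← (blockIndex n).sum_comp, Fintype.sum_prod_type]
    simp only [Pi.star_apply, hv]
    rw [Finset.sum_eq_single k (fun i _ hi => Finset.sum_eq_zero fun q _ => by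
      rw [if_neg hi, mul_zero]) (by simp)]
    by_cases hlk : l = k
    · subst hlk
      simpa [dotProduct] using h1
    · simp [hlk, Ne.symm hlk]

/-- A nonzero idempotent matrix fixes a unit vector. -/
theorem exists_unit_fixed {ι : Type*} [Fintype ι] {a : Matrix ι ι ℂ} (ha : a * a = a)
    (ha0 : a ≠ 0) : ∃ ξ : ι → ℂ, a *ᵥ ξ = ξ ∧ star ξ ⬝ᵥ ξ = 1 := by
  obtain ⟨q, hq⟩ : ∃ q, (fun i => a i q) ≠ 0 := by
    by_contra! h
    exact ha0 (Matrix.ext fun i q => congrFun (h q) i)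
  let η : ι → ℂ := fun i => a i q
  have hη : a *ᵥ η = η := funext fun i => congrFun (congrFun ha i) q
  have hpos : 0 < ‖WithLp.toLp 2 η‖ := norm_pos_iff.2 fun h => hq (congrArg WithLp.ofLp h)
  have hnorm : star η ⬝ᵥ η = ((‖WithLp.toLp 2 η‖ : ℂ)) ^ 2 := by
    have h := inner_self_eq_norm_sq_to_K (𝕜 := ℂ) (WithLp.toLp 2 η)
    rwa [EuclideanSpace.inner_eq_star_dotProduct, dotProduct_comm] at h
  refine ⟨((‖WithLp.toLp 2 η‖ : ℂ))⁻¹ • η, by rw [mulVec_smul, hη], ?_⟩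
  have h0 : (‖WithLp.toLp 2 η‖ : ℂ) ≠ 0 := by exact_mod_cast hpos.ne'
  rw [star_smul, smul_dotProduct, dotProduct_smul, hnorm]
  simp only [star_inv₀, smul_eq_mul, Complex.star_def, Complex.conj_ofReal]
  field_simp

theorem hasDoubling_fermionSubalgebra : HasDoubling fermionSubalgebra := by
  rintro n e he
  obtain ⟨a, rfl⟩ := he.mem
  have haa : a * a = a := fermionEmbedding_injective n (by rw [map_mul]; exact he.mul_self)
  have ha0 : a ≠ 0 := fun h => he.ne_zero (by
    rw [h]
    exact map_zero (fermionEmbedding n))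
  obtain ⟨ξ, hξ, h1⟩ := exists_unit_fixed haa ha0
  obtain ⟨v, hv, hvv⟩ := exists_doubleMatrix_fixed hξ h1
  let z : Fin (2 ^ (n + 1)) := ⟨0, by positivity⟩
  let δ : Fin (2 ^ (n + 1)) → ℂ := Pi.single z 1
  have hδ : star δ = δ := by
    simp [δ]
  have hδδ : δ ⬝ᵥ δ = 1 := by simp [δ]
  let φ := fermionEmbedding (n + 1)
  have hE0 : vecMulVec δ δ ≠ 0 := fun h => by
    simpa [vecMulVec, δ] using congrFun (congrFun h z) z
  refine ⟨n + 1, n.le_succ, φ (vecMulVec δ δ), fun l => φ (vecMulVec (v l) δ),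
    ⟨⟨_, rfl⟩, ⟨?_, ?_⟩, ?_, ?_⟩, fun l => ⟨_, rfl⟩, ⟨fun l => ?_, fun l k hlk => ?_⟩, fun l => ?_⟩
  · rw [IsIdempotentElem, ← map_mul, vecMulVec_mul_vecMulVec, hδδ, one_smul]
  · rw [IsSelfAdjoint, ← map_star, star_eq_conjTranspose, conjTranspose_vecMulVec, hδ]
  · exact fun h => hE0 (fermionEmbedding_injective _ (h.trans (map_zero φ).symm))
  · rintro _ ⟨x, rfl⟩
    refine ⟨δ ⬝ᵥ x *ᵥ δ, ?_⟩
    change φ _ * φ x * φ _ = _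
    rw [← map_mul, ← map_mul, ← map_smul, mul_assoc, mul_vecMulVec, vecMulVec_mul_vecMulVec,
      vecMulVec_smul]
  · rw [← map_star, ← map_mul, star_eq_conjTranspose, conjTranspose_vecMulVec, hδ,
      vecMulVec_mul_vecMulVec, hvv, if_pos rfl, one_smul]
  · rw [← map_star, ← map_mul, star_eq_conjTranspose, conjTranspose_vecMulVec, hδ,
      vecMulVec_mul_vecMulVec, hvv, if_neg hlk, zero_smul, vecMulVec_zero, map_zero]
  · change fermionEmbedding n a * φ _ = φ _
    rw [← fermionEmbedding_doubleMatrix, ← map_mul, mul_vecMulVec, hv]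

/-- Every AF-algebra is a complemented subspace of the Fermion algebra. -/
theorem IsAFAlgebra.isComplementedIn_fermionAlgebra {A : Type*} [NonUnitalCStarAlgebra A]
    (hA : IsAFAlgebra A) : IsComplementedIn A FermionAlgebra :=
  hA.isComplementedIn hasDoubling_fermionSubalgebra fermionSubalgebra_mono
    (fun _ => inferInstance) dense_fermionSubalgebra

/-- A nonzero AF-algebra with doubling is isomorphic to the Fermion algebra: both are
isomorphic to the space of null sequences in the Fermion algebra. -/
theorem HasDoubling.nonempty_equiv_fermionAlgebra {A : Type*} [NonUnitalCStarAlgebra A]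
    [Nontrivial A] {S : ℕ → NonUnitalStarSubalgebra ℂ A} (hS : HasDoubling S) (hmono : Monotone S)
    (hfin : ∀ n, FiniteDimensional ℂ (S n)) (hd : Dense (⋃ n, (S n : Set A))) :
    Nonempty (A ≃L[ℂ] FermionAlgebra) := by
  have hAF : IsAFAlgebra A := ⟨S, hmono, hfin, hd⟩
  have hFA : IsComplementedIn FermionAlgebra A :=
    isAFAlgebra_fermionAlgebra.isComplementedIn hS hmono hfin hd
  have hF := isAFAlgebra_fermionAlgebra.nullSequences.isComplementedIn_fermionAlgebra
  obtain ⟨e⟩ := nonempty_equiv_nullSequences hF hAF.isComplementedIn_fermionAlgebra hFA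
  obtain ⟨e'⟩ := nonempty_equiv_nullSequences hF
    isAFAlgebra_fermionAlgebra.isComplementedIn_fermionAlgebra
    isAFAlgebra_fermionAlgebra.isComplementedIn_fermionAlgebra
  exact ⟨e.trans e'.symm⟩

end Fermion

theorem corollary1p4 (A : Type*) [NonUnitalCStarAlgebra A]
    (hAF : IsAFAlgebra A) (hsimple : IsSimpleCStarAlgebra A)
    (hinf : ¬ FiniteDimensional ℂ A) :
    Nonempty (A ≃L[ℂ] CompactOperatorAlgebra) ∨ Nonempty (A ≃L[ℂ] FermionAlgebra) := by
  have := hAF.separableSpace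
  have := hsimple.1
  obtain ⟨S, hmono, hfin, hd⟩ := hAF
  rcases hsimple.hasDoubling_or hmono hfin hd with hS | ⟨p, hp, hp0, hpA⟩
  · exact Or.inr (hS.nonempty_equiv_fermionAlgebra hmono hfin hd)
  · exact Or.inl (hsimple.nonempty_equiv_compactOperatorAlgebra hinf hp hp0 hpA)
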